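/- Let $(\mathcal M,\mathbf g)$ be a smooth vacuum spacetime, that is, a smooth $4$-manifold with a smooth Lorentzian metric of signature $(-,+,+,+)$ and $\mathbf{Ric}=0$, with Levi-Civita connection $\mathbf D$ and curvature $\mathbf R(W,Z,X,Y)=\mathbf g(W,\mathbf D_X\mathbf D_YZ-\mathbf D_Y\mathbf D_XZ-\mathbf D_{[X,Y]}Z)$. Let $\mathcal H\subset\mathcal M$ be a smooth embedded null hypersurface (possibly with boundary), and let $L$ be a smooth, nowhere vanishing null vector field tangent to $\mathcal H$ with $\mathbf D_LL=0$. Let $v$ be a smooth function on $\mathcal H$ whose null lapse $\Omega:=Lv$ is positive and whose level sets $S_v$ are smooth $2$-spheres. Let $\underline L$ be the null vector field along $\mathcal H$ orthogonal to the leaves $S_v$ with $\mathbf g(L,\underline L)=-2$. For vectors $X,Y$ tangent to the leaves set $$\chi(X,Y)=\mathbf g(\mathbf D_XL,Y),\quad \underline\chi(X,Y)=\mathbf g(\mathbf D_X\underline L,Y),\quad \zeta(X)=\tfrac12\mathbf g(\mathbf D_XL,\underline L),\quad \underline\eta(X)=\tfrac12\mathbf g(\mathbf D_L\underline L,X),$$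 $$\rho=\tfrac14\mathbf R(\underline L,L,\underline L,L),\qquad \check\rho=\rho-\tfrac12\,\widehat\chi\cdot\widehat{\underline\chi},$$ where traces $\mathrm{tr}$, trace-free parts $\widehat{\ }$, norms and contractions are taken with respect to the induced metric of the leaves. For a function $f$ on $\mathcal H$ let $\overline f$ be its mean value over the leaf $S_v$ with respect to area. Suppose that the foliation $(S_v)$ is canonical: on every leaf $$\triangle\!\!\!\!/\,\log\Omega=-\mathrm{div}\!\!\!\!/\;\zeta+\check\rho-\overline{\check\rho},\qquad \int_{S_v}\log\Omega=0,$$ where $\triangle\!\!\!\!/$ and $\mathrm{div}\!\!\!\!/$ are the Laplace-Beltrami operator and the divergence of the leaf. Then $\mathrm{tr}\,\underline\chi$ is differentiable on $\mathcal H$ and $$L(\mathrm{tr}\,\underline\chi)+\tfrac12\,\mathrm{tr}\,\chi\,\mathrm{tr}\,\underline\chi=2\,\overline{\check\rho}+2|\underline\eta|^2\qquad\text{on }\mathcal H.$$ -/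

import Mathlib

open Bundle Manifold MeasureTheory
open scoped ContDiff Manifold

noncomputable section

/-- The model space `ℝ⁴` of spacetime. -/
abbrev R4 : Type := EuclideanSpace ℝ (Fin 4)

/-- The standard unit `2`-sphere in `ℝ³`. -/
abbrev S2 : Type := Metric.sphere (0 : EuclideanSpace ℝ (Fin 3)) 1

/-- A smooth Lorentzian metric, of signature `(-,+,+,+)`, on a smooth `4`-manifold `M`. -/
structure LorentzMetric (M : Type*) [TopologicalSpace M] [ChartedSpace R4 M]
    [IsManifold (𝓡 4) ∞ M] where
  inner (x : M) : TangentSpace (𝓡 4) x →L[ℝ] TangentSpace (𝓡 4) x →L[ℝ] ℝ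
  symm (x : M) (u w : TangentSpace (𝓡 4) x) : inner x u w = inner x w u
  signature (x : M) : ∃ b : Module.Basis (Fin 4) ℝ (TangentSpace (𝓡 4) x),
    ∀ i j, inner x (b i) (b j) = if i = j then (if i = 0 then -1 else 1) else 0
  contMDiff : ContMDiff (𝓡 4) ((𝓡 4).prod 𝓘(ℝ, R4 →L[ℝ] R4 →L[ℝ] ℝ)) ∞
    (fun x ↦ TotalSpace.mk' (R4 →L[ℝ] R4 →L[ℝ] ℝ)
      (E := fun x : M ↦ TangentSpace (𝓡 4) x →L[ℝ] TangentSpace (𝓡 4) x →L[ℝ] ℝ) x (inner x))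

namespace LorentzMetric

variable {M : Type*} [TopologicalSpace M] [ChartedSpace R4 M] [IsManifold (𝓡 4) ∞ M]
  (g : LorentzMetric M)

/-- The metric read in the preferred chart `φ` around `x₀`: at `y` in the target of `φ` it is the
bilinear form `(u, w) ↦ g (dφ⁻¹ u) (dφ⁻¹ w)` on `ℝ⁴`. -/
def inChart (x₀ : M) (y : R4) : R4 →L[ℝ] R4 →L[ℝ] ℝ :=
  let A : R4 →L[ℝ] R4 := mfderiv 𝓘(ℝ, R4) (𝓡 4) (extChartAt (𝓡 4) x₀).symm y
  let G : R4 →L[ℝ] R4 →L[ℝ] ℝ := g.inner ((extChartAt (𝓡 4) x₀).symm y)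
  G.bilinearComp A A

/-- The Christoffel symbols of the Levi-Civita connection in the preferred chart around `x₀`, as the
bilinear map `(u, w) ↦ Γᵏᵢⱼ uⁱ wʲ`. It is the vector whose scalar product with any `t` is
`½ (∂ᵤ g(w, t) + ∂_w g(u, t) - ∂ₜ g(u, w))`. -/
def christoffel (x₀ : M) (y u w : R4) : R4 :=
  (g.inChart x₀ y).inverse
    ((1 / 2 : ℝ) • (fderiv ℝ (g.inChart x₀) y u w + fderiv ℝ (g.inChart x₀) y w u
      - ((fderiv ℝ (g.inChart x₀) y).flip u).flip w))

/-- The Riemann curvature `R(u, w) z = D_u D_w z - D_w D_u z - D_[u,w] z` at `x`, the tangent space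
at `x` being identified with `ℝ⁴` by the preferred chart around `x` (as it is in the definition of
`TangentSpace`). -/
def riemann (x : M) (u w z : R4) : R4 :=
  fderiv ℝ (fun y ↦ g.christoffel x y w z) (extChartAt (𝓡 4) x x) u
    - fderiv ℝ (fun y ↦ g.christoffel x y u z) (extChartAt (𝓡 4) x x) w
    + g.christoffel x (extChartAt (𝓡 4) x x) u (g.christoffel x (extChartAt (𝓡 4) x x) w z)
    - g.christoffel x (extChartAt (𝓡 4) x x) w (g.christoffel x (extChartAt (𝓡 4) x x) u z)

/-- The covariant curvature tensor `𝐑(a, b, c, d) = g(a, R(c, d) b)`. -/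
def curv (x : M) (a b c d : TangentSpace (𝓡 4) x) : ℝ :=
  g.inner x a (g.riemann x c d b)

/-- The Ricci tensor `Ric(u, w)`, the trace of `z ↦ R(z, u) w`. -/
def ricci (x : M) (u w : R4) : ℝ :=
  ∑ i : Fin 4, g.riemann x (EuclideanSpace.single i 1) u w i

/-- The Einstein vacuum equations `Ric = 0`. -/
def IsVacuum : Prop := ∀ (x : M) (u w : R4), g.ricci x u w = 0

/-- The covariant derivative `D_X Y` at `q`, for the Levi-Civita connection of `g`, of a vector
field `Y` of `M` defined along a map `ι : H → M`, in the direction `X` tangent to `H`: in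
coordinates, `X(Yᵏ) + Γᵏᵢⱼ (dι X)ⁱ Yʲ`. -/
def covAlong {E : Type*} [NormedAddCommGroup E] [NormedSpace ℝ E] {K : Type*} [TopologicalSpace K]
    (I : ModelWithCorners ℝ E K) {H : Type*} [TopologicalSpace H] [ChartedSpace K H]
    (ι : H → M) (Y : (q : H) → TangentSpace (𝓡 4) (ι q)) (q : H) (X : TangentSpace I q) :
    TangentSpace (𝓡 4) (ι q) :=
  let Ycoord : H → R4 := fun q' ↦
    (trivializationAt R4 (TangentSpace (𝓡 4) : M → Type _) (ι q)
      (⟨ι q', Y q'⟩ : TangentBundle (𝓡 4) M)).2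
  let dY : R4 := mfderiv I 𝓘(ℝ, R4) Ycoord q X
  dY + g.christoffel (ι q) (extChartAt (𝓡 4) (ι q) (ι q)) (mfderiv I (𝓡 4) ι q X) (Y q)

end LorentzMetric

/-- The derivative `X f` at `q` of a scalar function `f` on `H` along a tangent vector `X`. -/
def dirDeriv {E : Type*} [NormedAddCommGroup E] [NormedSpace ℝ E] {K : Type*} [TopologicalSpace K]
    (I : ModelWithCorners ℝ E K) {H : Type*} [TopologicalSpace H] [ChartedSpace K H]
    (f : H → ℝ) (q : H) (X : TangentSpace I q) : ℝ :=
  mfderiv I 𝓘(ℝ, ℝ) f q X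

/-- A null hypersurface of `(M, g)`: an embedded `3`-manifold `H` (possibly with boundary), together
with a smooth tangent vector field `L` that is nowhere zero, orthogonal to `H` (so that `L` is
null, since it is tangent to `H`) and geodesic. -/
structure NullHypersurface {M : Type*} [TopologicalSpace M] [ChartedSpace R4 M]
    [IsManifold (𝓡 4) ∞ M] (g : LorentzMetric M)
    {K : Type*} [TopologicalSpace K] (I : ModelWithCorners ℝ (EuclideanSpace ℝ (Fin 3)) K)
    (H : Type*) [TopologicalSpace H] [ChartedSpace K H] [IsManifold I ∞ H] where
  ι : H → M
  contMDiff_ι : ContMDiff I (𝓡 4) ∞ ι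
  isEmbedding_ι : Topology.IsEmbedding ι
  immersion_ι (q : H) : Function.Injective (mfderiv I (𝓡 4) ι q)
  L (q : H) : TangentSpace I q
  contMDiff_L : ContMDiff I I.tangent ∞ (fun q ↦ (⟨q, L q⟩ : TangentBundle I H))
  L_ne_zero (q : H) : L q ≠ 0
  L_orthogonal (q : H) (X : TangentSpace I q) :
    g.inner (ι q) (mfderiv I (𝓡 4) ι q (L q)) (mfderiv I (𝓡 4) ι q X) = 0
  L_geodesic (q : H) : g.covAlong I ι (fun q' ↦ mfderiv I (𝓡 4) ι q' (L q')) q (L q) = 0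

/-- A foliation of a null hypersurface by the level sets `S_c = {v = c}` of a smooth function `v`
increasing along `L`, the leaves being smooth `2`-spheres, together with its null pair `(L, Lbar)`:
`Lbar` is the null vector field orthogonal to the leaves with `g(L, Lbar) = -2`. The map `param c`
is a smooth parametrisation of the leaf `S_c` by the standard sphere; it is only used to integrate
over `S_c`, and there is no relation between the parametrisations of different leaves. -/
structure NullFoliation {M : Type*} [TopologicalSpace M] [ChartedSpace R4 M]
    [IsManifold (𝓡 4) ∞ M] (g : LorentzMetric M)
    {K : Type*} [TopologicalSpace K] (I : ModelWithCorners ℝ (EuclideanSpace ℝ (Fin 3)) K)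
    (H : Type*) [TopologicalSpace H] [ChartedSpace K H] [IsManifold I ∞ H]
    extends NullHypersurface g I H where
  v : H → ℝ
  contMDiff_v : ContMDiff I 𝓘(ℝ, ℝ) ∞ v
  lapse_pos (q : H) : 0 < dirDeriv I v q (L q)
  param : ℝ → S2 → H
  contMDiff_param (c : ℝ) (hc : c ∈ Set.range v) : ContMDiff (𝓡 2) I ∞ (param c)
  injective_param (c : ℝ) (hc : c ∈ Set.range v) : Function.Injective (param c)
  immersion_param (c : ℝ) (hc : c ∈ Set.range v) (θ : S2) :
    Function.Injective (mfderiv (𝓡 2) I (param c) θ)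
  range_param (c : ℝ) (hc : c ∈ Set.range v) : Set.range (param c) = {q | v q = c}
  Lbar (q : H) : TangentSpace (𝓡 4) (ι q)
  contMDiff_Lbar : ContMDiff I (𝓡 4).tangent ∞ (fun q ↦ (⟨ι q, Lbar q⟩ : TangentBundle (𝓡 4) M))
  Lbar_null (q : H) : g.inner (ι q) (Lbar q) (Lbar q) = 0
  inner_L_Lbar (q : H) : g.inner (ι q) (mfderiv I (𝓡 4) ι q (L q)) (Lbar q) = -2
  Lbar_orthogonal (q : H) (X : TangentSpace I q) (hX : dirDeriv I v q X = 0) :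
    g.inner (ι q) (Lbar q) (mfderiv I (𝓡 4) ι q X) = 0

namespace NullFoliation

variable {M : Type*} [TopologicalSpace M] [ChartedSpace R4 M] [IsManifold (𝓡 4) ∞ M]
  {g : LorentzMetric M}
  {K : Type*} [TopologicalSpace K] {I : ModelWithCorners ℝ (EuclideanSpace ℝ (Fin 3)) K}
  {H : Type*} [TopologicalSpace H] [ChartedSpace K H] [IsManifold I ∞ H]
  (F : NullFoliation g I H)

/-- A vector tangent to `H`, regarded as a vector of `M`. -/
def push (q : H) (X : TangentSpace I q) : TangentSpace (𝓡 4) (F.ι q) :=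
  mfderiv I (𝓡 4) F.ι q X

/-- The spacetime covariant derivative `D_X Y` of a vector field `Y` along `H`. -/
def D (Y : (q : H) → TangentSpace (𝓡 4) (F.ι q)) (q : H) (X : TangentSpace I q) :
    TangentSpace (𝓡 4) (F.ι q) :=
  g.covAlong I F.ι Y q X

/-- The null lapse `Ω = L v`. -/
def lapse (q : H) : ℝ := dirDeriv I F.v q (F.L q)

/-- The metric on `TH`; on vectors tangent to a leaf it is the induced metric of the leaf. -/
def slash (q : H) (X Y : TangentSpace I q) : ℝ :=
  g.inner (F.ι q) (F.push q X) (F.push q Y)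

/-- `(e 0, e 1)` is an orthonormal basis of the tangent space at `q` of the leaf through `q`. -/
def IsFrame (q : H) (e : Fin 2 → TangentSpace I q) : Prop :=
  (∀ A, dirDeriv I F.v q (e A) = 0) ∧ ∀ A B, F.slash q (e A) (e B) = if A = B then 1 else 0

/-- An orthonormal basis `(e₁, e₂)` of the tangent space at `q` of the leaf through `q`. It is used
for contractions only, which do not depend on its choice. -/
def e (q : H) : Fin 2 → TangentSpace I q :=
  Classical.epsilon (F.IsFrame q)

/-- `χ(X, Y) = g(D_X L, Y)`. -/
def chi (q : H) (X Y : TangentSpace I q) : ℝ :=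
  g.inner (F.ι q) (F.D (fun q' ↦ F.push q' (F.L q')) q X) (F.push q Y)

/-- `χ̲(X, Y) = g(D_X Lbar, Y)`. -/
def chibar (q : H) (X Y : TangentSpace I q) : ℝ :=
  g.inner (F.ι q) (F.D F.Lbar q X) (F.push q Y)

/-- `ζ(X) = ½ g(D_X L, Lbar)`. -/
def zeta (q : H) (X : TangentSpace I q) : ℝ :=
  1 / 2 * g.inner (F.ι q) (F.D (fun q' ↦ F.push q' (F.L q')) q X) (F.Lbar q)

/-- `η̲(X) = ½ g(D_L Lbar, X)`. -/
def etabar (q : H) (X : TangentSpace I q) : ℝ :=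
  1 / 2 * g.inner (F.ι q) (F.D F.Lbar q (F.L q)) (F.push q X)

/-- The trace, on the leaf through `q`, of a bilinear form. -/
def tr (T : (q : H) → TangentSpace I q → TangentSpace I q → ℝ) (q : H) : ℝ :=
  ∑ A, T q (F.e q A) (F.e q A)

/-- The trace-free part of a bilinear form on the leaf. -/
def hat (T : (q : H) → TangentSpace I q → TangentSpace I q → ℝ) (q : H)
    (X Y : TangentSpace I q) : ℝ :=
  T q X Y - 1 / 2 * F.tr T q * F.slash q X Y

/-- The scalar product `T · T'` of two bilinear forms on the leaf. -/
def dot₂ (T T' : (q : H) → TangentSpace I q → TangentSpace I q → ℝ) (q : H) : ℝ :=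
  ∑ A, ∑ B, T q (F.e q A) (F.e q B) * T' q (F.e q A) (F.e q B)

/-- The square norm `|ξ|²` of a `1`-form on the leaf. -/
def normSq (ξ : (q : H) → TangentSpace I q → ℝ) (q : H) : ℝ :=
  ∑ A, ξ q (F.e q A) ^ 2

/-- The leaf-tangent vector field dual to a `1`-form on the leaves. -/
def sharp (ξ : (q : H) → TangentSpace I q → ℝ) (q : H) : TangentSpace I q :=
  ∑ A, ξ q (F.e q A) • F.e q A

/-- The induced covariant derivative `∇̸_X W` on the leaves of a leaf-tangent vector field `W`:
the orthogonal projection of `D_X W` to the tangent space of the leaf. -/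
def leafCov (W : (q : H) → TangentSpace I q) (q : H) (X : TangentSpace I q) : TangentSpace I q :=
  ∑ A, g.inner (F.ι q) (F.D (fun q' ↦ F.push q' (W q')) q X) (F.push q (F.e q A)) • F.e q A

/-- The divergence on the leaves of a `1`-form, `div̸ ξ = g̸(∇̸_A ξ♯, e_A)`. -/
def div (ξ : (q : H) → TangentSpace I q → ℝ) (q : H) : ℝ :=
  ∑ A, F.slash q (F.leafCov (F.sharp ξ) q (F.e q A)) (F.e q A)

/-- The Laplace-Beltrami operator of the leaves, `△̸ f = div̸ (df)`. -/
def laplacian (f : H → ℝ) (q : H) : ℝ := F.div (dirDeriv I f) q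

/-- `ρ = ¼ 𝐑(Lbar, L, Lbar, L)`. -/
def rho (q : H) : ℝ :=
  1 / 4 * g.curv (F.ι q) (F.Lbar q) (F.push q (F.L q)) (F.Lbar q) (F.push q (F.L q))

/-- The renormalised component `ρ̌ = ρ - ½ χ̂ · χ̲̂`. -/
def rhoCheck (q : H) : ℝ :=
  F.rho q - 1 / 2 * F.dot₂ (F.hat F.chi) (F.hat F.chibar) q

/-- The ratio, at `θ`, of the area element of the leaf `S_c`, pulled back by `param c`, to the area
element of the round unit sphere: the square root of the quotient of the Gram determinants of the
two metrics in one and the same basis of the tangent space at `θ`. -/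
def areaDensity (c : ℝ) (θ : S2) : ℝ :=
  let b : Fin 2 → TangentSpace (𝓡 2) θ := fun i ↦
    (EuclideanSpace.single i 1 : EuclideanSpace ℝ (Fin 2))
  let d : TangentSpace (𝓡 2) θ → EuclideanSpace ℝ (Fin 3) := fun w ↦
    mfderiv (𝓡 2) 𝓘(ℝ, EuclideanSpace ℝ (Fin 3))
      (fun θ' : S2 ↦ (θ' : EuclideanSpace ℝ (Fin 3))) θ w
  √((Matrix.of fun i j ↦ F.slash (F.param c θ) (mfderiv (𝓡 2) I (F.param c) θ (b i))
        (mfderiv (𝓡 2) I (F.param c) θ (b j))).det /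
    (Matrix.of fun i j ↦ inner ℝ (d (b i)) (d (b j))).det)

/-- The integral of `f` over the leaf `S_c` with respect to its area. -/
def leafIntegral (f : H → ℝ) (c : ℝ) : ℝ :=
  ∫ θ : S2, f (F.param c θ) * F.areaDensity c θ
    ∂((volume : Measure (EuclideanSpace ℝ (Fin 3))).toSphere)

/-- The mean value of `f` on the leaf `S_c`. -/
def leafMean (f : H → ℝ) (c : ℝ) : ℝ :=
  F.leafIntegral f c / F.leafIntegral (fun _ ↦ 1) c

/-- The foliation is canonical: on every leaf `△̸ log Ω = - div̸ ζ + ρ̌ - mean(ρ̌)` and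
`∫ log Ω = 0`. -/
structure IsCanonical : Prop where
  elliptic (q : H) : F.laplacian (fun q' ↦ Real.log (F.lapse q')) q =
    - F.div F.zeta q + F.rhoCheck q - F.leafMean F.rhoCheck (F.v q)
  normalised (c : ℝ) (hc : c ∈ Set.range F.v) :
    F.leafIntegral (fun q ↦ Real.log (F.lapse q)) c = 0

end NullFoliation

end

set_option maxSynthPendingDepth 3

noncomputable section

/-! ### Levi-Civita connections on an open subset of a vector space. -/

section LocalGeometry

variable {E F : Type*} [NormedAddCommGroup E] [NormedSpace ℝ E]
  [NormedAddCommGroup F] [NormedSpace ℝ F]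

/-! Take a smooth orthonormal frame `e_A` of the leaves and differentiate `tr χ̲ = ∑ g(D_A Lbar,
e_A)` along `L`. Commuting `D_L` with `D_A` on `Lbar` produces a curvature term, the divergence of
`D_L Lbar = 2 η̲♯`, and terms from the bracket `[L, e_A]`. The rotation of the frame along `L` drops
out because its coefficients are skew, and what remains is `LocalNullFoliation.transport`: `L(tr χ̲)
= 2 div η̲ + ∑ g(R(L, e_A) Lbar, e_A) - χ·χ̲ + 2|η̲|²`.

Three facts turn this into the claim. In vacuum, `Ric(L, Lbar) = 0` makes the curvature sum equal to
`2ρ` (`IsVacuum.sum_riemann`). In dimension two, `χ·χ̲ = χ̂·χ̲̂ + ½ tr χ tr χ̲` (`dot₂_hat`), so `2ρ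
- χ·χ̲ = 2ρ̌ - ½ tr χ tr χ̲`. Finally, applying `[L, e_A]` to `v` gives `η̲ = -ζ - d log Ω`
(`LocalNullFoliation.etabar_eq`), whence `div η̲ = -div ζ - △ log Ω`, which the canonical equation
identifies with `mean(ρ̌) - ρ̌`. The pointwise `ρ̌` cancels and only its mean is left.

The remaining work is the passage to coordinates. Covariant derivatives are defined at each point in
the preferred chart of that point, and contractions use an arbitrarily chosen basis `F.e q`; neither
can be differentiated as it stands. The transformation law of the Christoffel symbols
(`symbol_change`) lets every covariant derivative be computed in one fixed chart
(`tangentCoordChange_covAlong`), `exists_localNullFoliation` extends `F.e q` to a smooth frame near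
`q`, and `IsFrame.sum_eq` allows that frame to replace the chosen bases. Since `H` may have a
boundary, derivatives on it are taken within a set contained in the closure of its interior, where
second derivatives are still symmetric. -/

theorem minSmoothness_two_le_infty : minSmoothness ℝ 2 ≤ ∞ := by
  simp only [minSmoothness_of_isRCLikeNormedField]
  exact WithTop.coe_le_coe.mpr le_top

/-- `Γ` is the Christoffel symbol of the Levi-Civita connection of the pseudo-Riemannian metric `G`
on the open set `W`. -/
structure IsLeviCivitaOn (G : F → F →L[ℝ] F →L[ℝ] ℝ) (Γ : F → F →L[ℝ] F →L[ℝ] F)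
    (W : Set F) : Prop where
  isOpen : IsOpen W
  contDiffOn_metric : ContDiffOn ℝ ∞ G W
  contDiffOn_symbol : ContDiffOn ℝ ∞ Γ W
  metric_symm {z : F} (hz : z ∈ W) (u w : F) : G z u w = G z w u
  nondegenerate {z : F} (hz : z ∈ W) (u : F) (hu : ∀ w, G z u w = 0) : u = 0
  symbol_symm {z : F} (hz : z ∈ W) (u w : F) : Γ z u w = Γ z w u
  compatible {z : F} (hz : z ∈ W) (u w t : F) :
    fderiv ℝ G z u w t = G z (Γ z u w) t + G z w (Γ z u t)

/-- The curvature of a connection with symbol `Γ`. -/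
def localRiemann (Γ : F → F →L[ℝ] F →L[ℝ] F) (z u w t : F) : F :=
  fderiv ℝ Γ z u w t - fderiv ℝ Γ z w u t + Γ z u (Γ z w t) - Γ z w (Γ z u t)

/-- The covariant derivative of a field `Y` along a map `f` defined on the set `U`. -/
def localCov (Γ : F → F →L[ℝ] F →L[ℝ] F) (f : E → F) (U : Set E) (Y : E → F) (y X : E) : F :=
  fderivWithin ℝ Y U y X + Γ (f y) (fderivWithin ℝ f U y X) (Y y)

variable {G : F → F →L[ℝ] F →L[ℝ] ℝ} {Γ : F → F →L[ℝ] F →L[ℝ] F} {W : Set F}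

namespace IsLeviCivitaOn

theorem differentiableAt_metric (h : IsLeviCivitaOn G Γ W) {z : F} (hz : z ∈ W) :
    DifferentiableAt ℝ G z :=
  (h.contDiffOn_metric.contDiffAt (h.isOpen.mem_nhds hz)).differentiableAt (by simp)

theorem differentiableAt_symbol (h : IsLeviCivitaOn G Γ W) {z : F} (hz : z ∈ W) :
    DifferentiableAt ℝ Γ z :=
  (h.contDiffOn_symbol.contDiffAt (h.isOpen.mem_nhds hz)).differentiableAt (by simp)

/-- The curvature operator is skew-adjoint. -/
theorem metric_localRiemann_skew (h : IsLeviCivitaOn G Γ W) {z : F} (hz : z ∈ W) (u w a b : F) :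
    G z (localRiemann Γ z u w a) b = - G z (localRiemann Γ z u w b) a := by
  have hG := h.contDiffOn_metric.contDiffAt (h.isOpen.mem_nhds hz)
  have hsymm : IsSymmSndFDerivAt ℝ G z := hG.isSymmSndFDerivAt minSmoothness_two_le_infty
  have hG2 : DifferentiableAt ℝ (fderiv ℝ G) z :=
    (hG.fderiv_right (m := ∞) (by simp)).differentiableAt (by simp)
  -- Differentiate metric compatibility once more. The left side is symmetric in `u`, `w`, so
  -- antisymmetrising the right side leaves only curvature terms.
  have key : ∀ u w : F, fderiv ℝ (fderiv ℝ G) z u w a b =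
      fderiv ℝ G z u (Γ z w a) b + G z (fderiv ℝ Γ z u w a) b
        + fderiv ℝ G z u a (Γ z w b) + G z a (fderiv ℝ Γ z u w b) := by
    intro u w
    have h1 : HasFDerivAt (fun z' ↦ fderiv ℝ G z' w a b) _ z :=
      ((hG2.hasFDerivAt.clm_apply (hasFDerivAt_const w z)).clm_apply
        (hasFDerivAt_const a z)).clm_apply (hasFDerivAt_const b z)
    have hΓ : ∀ c : F, HasFDerivAt (fun z' ↦ Γ z' w c) _ z := fun c ↦
      (((h.differentiableAt_symbol hz).hasFDerivAt.clm_apply (hasFDerivAt_const w z)).clm_apply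
        (hasFDerivAt_const c z))
    have hGd := (h.differentiableAt_metric hz).hasFDerivAt
    have h2 : HasFDerivAt (fun z' ↦ G z' (Γ z' w a) b + G z' a (Γ z' w b)) _ z :=
      ((hGd.clm_apply (hΓ a)).clm_apply (hasFDerivAt_const b z)).add
        ((hGd.clm_apply (hasFDerivAt_const a z)).clm_apply (hΓ b))
    have h3 : (fun z' ↦ fderiv ℝ G z' w a b) =ᶠ[nhds z]
        (fun z' ↦ G z' (Γ z' w a) b + G z' a (Γ z' w b)) := by
      filter_upwards [h.isOpen.mem_nhds hz] with z' hz'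
      exact h.compatible hz' w a b
    have h4 := congrArg (fun l : F →L[ℝ] ℝ ↦ l u) ((h2.congr_of_eventuallyEq h3).unique h1)
    simp at h4
    linarith
  have e1 := key u w
  have e2 := key w u
  have e3 : fderiv ℝ (fderiv ℝ G) z u w a b = fderiv ℝ (fderiv ℝ G) z w u a b := by
    rw [hsymm.eq u w]
  simp only [h.compatible hz] at e1 e2
  simp only [localRiemann, map_add, map_sub, add_apply,
    sub_apply]
  rw [h.metric_symm hz (fderiv ℝ Γ z u w b) a, h.metric_symm hz (fderiv ℝ Γ z w u b) a,
    h.metric_symm hz (Γ z u (Γ z w b)) a, h.metric_symm hz (Γ z w (Γ z u b)) a]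
  linarith

/-- The transformation law of the Christoffel symbols under a change of coordinates `ψ`. -/
theorem symbol_change {G' : F → F →L[ℝ] F →L[ℝ] ℝ} {Γ' : F → F →L[ℝ] F →L[ℝ] F} {W' : Set F}
    (h : IsLeviCivitaOn G Γ W) (h' : IsLeviCivitaOn G' Γ' W') {ψ : F → F} {z : F} (hz : z ∈ W)
    (hz' : ψ z ∈ W') (hψ : ContDiffAt ℝ ∞ ψ z)
    (hsurj : Function.Surjective (fderiv ℝ ψ z))
    (hG : ∀ᶠ z₁ in nhds z, ∀ u w, G z₁ u w = G' (ψ z₁) (fderiv ℝ ψ z₁ u) (fderiv ℝ ψ z₁ w))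
    (u w : F) :
    Γ' (ψ z) (fderiv ℝ ψ z u) (fderiv ℝ ψ z w) + fderiv ℝ (fderiv ℝ ψ) z u w =
      fderiv ℝ ψ z (Γ z u w) := by
  have hψ1 := (hψ.differentiableAt (by simp)).hasFDerivAt
  have hψ2 := ((hψ.fderiv_right (m := ∞) (by simp)).differentiableAt (by simp)).hasFDerivAt
  have hsymm : IsSymmSndFDerivAt ℝ ψ z := hψ.isSymmSndFDerivAt minSmoothness_two_le_infty
  have hGz := hG.self_of_nhds
  set A := fderiv ℝ ψ z with hA
  set A₂ := fderiv ℝ (fderiv ℝ ψ) z with hA₂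
  -- `δ` is the defect in the transformation law. It is symmetric because both connections are
  -- torsion free, and, lowered with `G'`, skew in its last two slots because both are metric. A
  -- trilinear form with these two symmetries vanishes, as in the uniqueness of the Levi-Civita
  -- connection.
  let δ : F → F → F := fun u w ↦ Γ' (ψ z) (A u) (A w) + A₂ u w - A (Γ z u w)
  have δ_symm : ∀ u w, δ u w = δ w u := by
    intro u w
    simp only [δ]
    rw [h'.symbol_symm hz', h.symbol_symm hz, hsymm.eq u w]
  have δ_skew : ∀ u w t, G' (ψ z) (δ u w) (A t) + G' (ψ z) (A w) (δ u t) = 0 := by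
    intro u w t
    have h1 : HasFDerivAt (fun z₁ ↦ G z₁ w t) _ z :=
      (((h.differentiableAt_metric hz).hasFDerivAt.clm_apply (hasFDerivAt_const w z)).clm_apply
        (hasFDerivAt_const t z))
    have hG' : HasFDerivAt (fun z₁ ↦ G' (ψ z₁)) _ z :=
      (h'.differentiableAt_metric hz').hasFDerivAt.comp z hψ1
    have h2 : HasFDerivAt (fun z₁ ↦ G' (ψ z₁) (fderiv ℝ ψ z₁ w) (fderiv ℝ ψ z₁ t)) _ z :=
      (hG'.clm_apply (hψ2.clm_apply (hasFDerivAt_const w z))).clm_apply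
        (hψ2.clm_apply (hasFDerivAt_const t z))
    have h3 : (fun z₁ ↦ G z₁ w t) =ᶠ[nhds z]
        (fun z₁ ↦ G' (ψ z₁) (fderiv ℝ ψ z₁ w) (fderiv ℝ ψ z₁ t)) := by
      filter_upwards [hG] with z₁ hz₁ using hz₁ w t
    have h4 := congrArg (fun l : F →L[ℝ] ℝ ↦ l u) ((h2.congr_of_eventuallyEq h3).unique h1)
    simp [h.compatible hz, h'.compatible hz', hGz, ← hA] at h4
    simp only [δ, map_add, map_sub, add_apply, sub_apply]
    linarith
  have δ_zero : ∀ u w t, G' (ψ z) (δ u w) (A t) = 0 := by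
    intro u w t
    have e1 := δ_skew u w t
    have e2 := δ_skew w t u
    have e3 := δ_skew t u w
    rw [h'.metric_symm hz' (A w), δ_symm u t] at e1
    rw [h'.metric_symm hz' (A t)] at e2
    rw [h'.metric_symm hz' (A u)] at e3
    rw [δ_symm w u] at e2
    rw [δ_symm t w] at e3
    linarith
  refine sub_eq_zero.mp (h'.nondegenerate hz' _ fun t' ↦ ?_)
  obtain ⟨t, rfl⟩ := hsurj t'
  exact δ_zero u w t

end IsLeviCivitaOn

/-! ### Covariant derivatives along a map: metric compatibility, torsion, curvature. -/

section Along

variable {U : Set E} {f : E → F} {Y Z : E → F} {y : E}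

theorem localCov_add_right (X X' : E) :
    localCov Γ f U Y y (X + X') = localCov Γ f U Y y X + localCov Γ f U Y y X' := by
  simp only [localCov, map_add, add_apply]; abel

theorem localCov_smul_right (c : ℝ) (X : E) :
    localCov Γ f U Y y (c • X) = c • localCov Γ f U Y y X := by
  simp [localCov]

theorem contDiffOn_localCov (hU : UniqueDiffOn ℝ U) (hΓ : ContDiffOn ℝ ∞ Γ W)
    (hfW : Set.MapsTo f U W) (hf : ContDiffOn ℝ ∞ f U) (hY : ContDiffOn ℝ ∞ Y U) {X : E → E}
    (hX : ContDiffOn ℝ ∞ X U) :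
    ContDiffOn ℝ ∞ (fun y ↦ localCov Γ f U Y y (X y)) U :=
  ((hY.fderivWithin hU (by simp)).clm_apply hX).add
    (((hΓ.comp hf hfW).clm_apply ((hf.fderivWithin hU (by simp)).clm_apply hX)).clm_apply hY)

theorem localCov_add (hU : UniqueDiffWithinAt ℝ U y) (hY : DifferentiableWithinAt ℝ Y U y)
    (hZ : DifferentiableWithinAt ℝ Z U y) (X : E) :
    localCov Γ f U (fun y ↦ Y y + Z y) y X = localCov Γ f U Y y X + localCov Γ f U Z y X := by
  simp only [localCov]
  rw [fderivWithin_fun_add hU hY hZ]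
  simp only [map_add, add_apply]; abel

theorem localCov_const_smul (hU : UniqueDiffWithinAt ℝ U y)
    (hY : DifferentiableWithinAt ℝ Y U y) (c : ℝ) (X : E) :
    localCov Γ f U (fun y ↦ c • Y y) y X = c • localCov Γ f U Y y X := by
  simp only [localCov]
  rw [fderivWithin_fun_const_smul hU hY]
  simp

theorem localCov_congr (hy : y ∈ U) (h : Set.EqOn Y Z U) (X : E) :
    localCov Γ f U Y y X = localCov Γ f U Z y X := by
  simp only [localCov]
  rw [fderivWithin_congr h (h hy), h hy]

/-- The covariant derivative along a map is compatible with the metric. -/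
theorem IsLeviCivitaOn.fderivWithin_metric (h : IsLeviCivitaOn G Γ W)
    (hU : UniqueDiffWithinAt ℝ U y) (hfy : f y ∈ W) (hf : DifferentiableWithinAt ℝ f U y)
    (hY : DifferentiableWithinAt ℝ Y U y) (hZ : DifferentiableWithinAt ℝ Z U y) (X : E) :
    fderivWithin ℝ (fun y ↦ G (f y) (Y y) (Z y)) U y X =
      G (f y) (localCov Γ f U Y y X) (Z y) + G (f y) (Y y) (localCov Γ f U Z y X) := by
  have hG : HasFDerivWithinAt (fun y ↦ G (f y)) _ U y :=
    (h.differentiableAt_metric hfy).hasFDerivAt.comp_hasFDerivWithinAt y hf.hasFDerivWithinAt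
  rw [((hG.clm_apply hY.hasFDerivWithinAt).clm_apply hZ.hasFDerivWithinAt).fderivWithin hU]
  simp [localCov, h.compatible hfy]
  ring

/-- The covariant derivative along a map is torsion free. -/
theorem IsLeviCivitaOn.localCov_torsion (h : IsLeviCivitaOn G Γ W)
    (hU : UniqueDiffOn ℝ U) (hUi : U ⊆ closure (interior U)) (hy : y ∈ U) (hfy : f y ∈ W)
    (hf : ContDiffOn ℝ ∞ f U) {X X' : E → E} (hX : DifferentiableWithinAt ℝ X U y)
    (hX' : DifferentiableWithinAt ℝ X' U y) :
    localCov Γ f U (fun y ↦ fderivWithin ℝ f U y (X' y)) y (X y)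
        - localCov Γ f U (fun y ↦ fderivWithin ℝ f U y (X y)) y (X' y) =
      fderivWithin ℝ f U y (fderivWithin ℝ X' U y (X y) - fderivWithin ℝ X U y (X' y)) := by
  -- At a boundary point the symmetry passes to the limit from interior points; this is the role of
  -- `hUi`.
  have hs : IsSymmSndFDerivWithinAt ℝ f U y :=
    (hf y hy).isSymmSndFDerivWithinAt minSmoothness_two_le_infty hU (hUi hy) hy
  have hf2 := ((hf.fderivWithin (m := ∞) hU (by simp)).differentiableOn (by simp) y
    hy).hasFDerivWithinAt
  simp only [localCov]
  rw [(hf2.clm_apply hX'.hasFDerivWithinAt).fderivWithin (hU y hy),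
    (hf2.clm_apply hX.hasFDerivWithinAt).fderivWithin (hU y hy)]
  simp only [add_apply, ContinuousLinearMap.comp_apply,
    ContinuousLinearMap.flip_apply, map_sub]
  rw [hs.eq, h.symbol_symm hfy]
  abel

/-- The commutator of covariant derivatives along a map is the curvature. -/
theorem IsLeviCivitaOn.localCov_curvature (h : IsLeviCivitaOn G Γ W)
    (hU : UniqueDiffOn ℝ U) (hUi : U ⊆ closure (interior U)) (hy : y ∈ U) (hfy : f y ∈ W)
    (hf : ContDiffOn ℝ ∞ f U) (hY : ContDiffOn ℝ ∞ Y U) {X X' : E → E}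
    (hX : DifferentiableWithinAt ℝ X U y) (hX' : DifferentiableWithinAt ℝ X' U y) :
    localCov Γ f U (fun y ↦ localCov Γ f U Y y (X' y)) y (X y)
        - localCov Γ f U (fun y ↦ localCov Γ f U Y y (X y)) y (X' y)
        - localCov Γ f U Y y (fderivWithin ℝ X' U y (X y) - fderivWithin ℝ X U y (X' y)) =
      localRiemann Γ (f y) (fderivWithin ℝ f U y (X y)) (fderivWithin ℝ f U y (X' y)) (Y y) := by
  have hs : IsSymmSndFDerivWithinAt ℝ f U y :=
    (hf y hy).isSymmSndFDerivWithinAt minSmoothness_two_le_infty hU (hUi hy) hy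
  have hsY : IsSymmSndFDerivWithinAt ℝ Y U y :=
    (hY y hy).isSymmSndFDerivWithinAt minSmoothness_two_le_infty hU (hUi hy) hy
  have hf1 := (hf.differentiableOn (by simp) y hy).hasFDerivWithinAt
  have hY1 := (hY.differentiableOn (by simp) y hy).hasFDerivWithinAt
  have hf2 := ((hf.fderivWithin (m := ∞) hU (by simp)).differentiableOn (by simp) y
    hy).hasFDerivWithinAt
  have hY2 := ((hY.fderivWithin (m := ∞) hU (by simp)).differentiableOn (by simp) y
    hy).hasFDerivWithinAt
  have hΓ : HasFDerivWithinAt (fun y ↦ Γ (f y)) _ U y :=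
    (h.differentiableAt_symbol hfy).hasFDerivAt.comp_hasFDerivWithinAt y hf1
  have key : ∀ V : E → E, DifferentiableWithinAt ℝ V U y → fderivWithin ℝ
      (fun y ↦ fderivWithin ℝ Y U y (V y) + Γ (f y) (fderivWithin ℝ f U y (V y)) (Y y)) U y = _ :=
    fun V hV ↦ ((hY2.clm_apply hV.hasFDerivWithinAt).add
      ((hΓ.clm_apply (hf2.clm_apply hV.hasFDerivWithinAt)).clm_apply hY1)).fderivWithin (hU y hy)
  simp only [localCov]
  rw [key X hX, key X' hX']
  simp only [add_apply, ContinuousLinearMap.comp_apply,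
    ContinuousLinearMap.flip_apply, map_sub, map_add, sub_apply, localRiemann]
  rw [hs.eq, hsY.eq]
  abel

end Along

end LocalGeometry

end

noncomputable section

/-! ### Linear algebra of null frames. -/

section NullFrame

variable {F : Type*} [NormedAddCommGroup F] [NormedSpace ℝ F]

/-- `(e 0, e 1, l, m)` is a null frame for the bilinear form `g`: the vectors `e 0`, `e 1` are
orthonormal, `l` and `m` are null vectors orthogonal to them, and `g l m = -2`. -/
structure IsNullFrame (g : F →L[ℝ] F →L[ℝ] ℝ) (e : Fin 2 → F) (l m : F) : Prop where
  symm (u w : F) : g u w = g w u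
  nondegenerate (u : F) (hu : ∀ w, g u w = 0) : u = 0
  e_e (A B : Fin 2) : g (e A) (e B) = if A = B then 1 else 0
  e_l (A : Fin 2) : g (e A) l = 0
  e_m (A : Fin 2) : g (e A) m = 0
  l_l : g l l = 0
  m_m : g m m = 0
  l_m : g l m = -2

namespace IsNullFrame

variable {g : F →L[ℝ] F →L[ℝ] ℝ} {e : Fin 2 → F} {l m : F}

/-- Pairing with the frame isolates each coefficient of a linear combination, so the four vectors
form a basis. As `g l m = -2`, the coefficient of `l` is read off by pairing with `m` and
conversely, which accounts for the factors `-1/2`. -/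
theorem expansion (h : IsNullFrame g e l m) (hF : Module.finrank ℝ F = 4) (u : F) :
    u = ∑ A, g u (e A) • e A - (1 / 2 * g u m) • l - (1 / 2 * g u l) • m := by
  have : FiniteDimensional ℝ F := .of_finrank_pos (by omega)
  have hml : g m l = -2 := by rw [h.symm, h.l_m]
  have hle : ∀ A, g l (e A) = 0 := fun A ↦ by rw [h.symm, h.e_l]
  have hme : ∀ A, g m (e A) = 0 := fun A ↦ by rw [h.symm, h.e_m]
  have hli : LinearIndependent ℝ ![e 0, e 1, l, m] := by
    rw [Fintype.linearIndependent_iff]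
    intro c hc
    have hc' : ∀ w, g (∑ i, c i • (![e 0, e 1, l, m] : Fin 4 → F) i) w = 0 := by simp [hc]
    have h0 := hc' (e 0)
    have h1 := hc' (e 1)
    have h2 := hc' l
    have h3 := hc' m
    simp [Fin.sum_univ_four, h.e_e, h.e_l, h.e_m, h.l_l, h.m_m, h.l_m, hml, hle, hme]
      at h0 h1 h2 h3
    intro i
    fin_cases i <;> simp [*]
  let b := basisOfLinearIndependentOfCardEqFinrank hli (by simp [hF])
  refine sub_eq_zero.mp (h.nondegenerate _ fun w ↦ ?_)
  set d := u - (∑ A, g u (e A) • e A - (1 / 2 * g u m) • l - (1 / 2 * g u l) • m) with hd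
  have hz : ∀ i, g d (b i) = 0 := by
    intro i
    have : ∀ i, g d ((![e 0, e 1, l, m] : Fin 4 → F) i) = 0 := by
      intro i
      fin_cases i <;>
        simp [hd, Fin.sum_univ_two, h.e_e, h.e_l, h.e_m, h.l_l, h.m_m, h.l_m, hml, hle, hme]
      all_goals ring
    simpa [b] using this i
  have : (g d : F →ₗ[ℝ] ℝ) = 0 := b.ext fun i ↦ by simpa using hz i
  exact congrArg (fun φ : F →ₗ[ℝ] ℝ ↦ φ w) this

theorem expansion_of_orthogonal (h : IsNullFrame g e l m) (hF : Module.finrank ℝ F = 4) {u : F}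
    (hl : g u l = 0) (hm : g u m = 0) : u = ∑ A, g u (e A) • e A := by
  conv_lhs => rw [h.expansion hF u, hl, hm]
  simp

/-- The expansion of `T u` displays `T` as a sum of rank-one maps `u ↦ φ(u) w`, each of trace
`φ(w)`. -/
theorem trace_eq (h : IsNullFrame g e l m) (hF : Module.finrank ℝ F = 4) (T : F →ₗ[ℝ] F) :
    LinearMap.trace ℝ F T =
      ∑ A, g (T (e A)) (e A) - 1 / 2 * g (T l) m - 1 / 2 * g (T m) l := by
  have : FiniteDimensional ℝ F := .of_finrank_pos (by omega)
  let φ : F → F →ₗ[ℝ] ℝ := fun w ↦ ((g.flip w : F →L[ℝ] ℝ) : F →ₗ[ℝ] ℝ) ∘ₗ T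
  have hT : T = ∑ A, (φ (e A)).smulRight (e A) - (1 / 2 : ℝ) • (φ m).smulRight l
      - (1 / 2 : ℝ) • (φ l).smulRight m := by
    ext u
    rw [h.expansion hF (T u)]
    simp [φ, smul_smul]
  rw [hT]
  simp only [map_sub, map_sum, map_smul, LinearMap.trace_smulRight]
  rw [← hT]
  simp [φ]

end IsNullFrame

end NullFrame

/-! ### The null structure equations in coordinates. -/

section LocalNullFoliation

variable {E F : Type*} [NormedAddCommGroup E] [NormedSpace ℝ E]
  [NormedAddCommGroup F] [NormedSpace ℝ F]

/-- A null hypersurface `f : U → W` with a geodesic null generator `L`, a function `v` increasing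
along `L`, the conjugate null normal `m` of its level sets and an orthonormal frame `e` of the
tangent spaces of the level sets, all in coordinates. -/
structure LocalNullFoliation (G : F → F →L[ℝ] F →L[ℝ] ℝ) (Γ : F → F →L[ℝ] F →L[ℝ] F) (W : Set F)
    (U : Set E) (f : E → F) (L : E → E) (m : E → F) (v : E → ℝ) (e : Fin 2 → E → E) : Prop where
  leviCivita : IsLeviCivitaOn G Γ W
  uniqueDiffOn : UniqueDiffOn ℝ U
  subset_closure_interior : U ⊆ closure (interior U)
  mapsTo : Set.MapsTo f U W
  contDiffOn_f : ContDiffOn ℝ ∞ f U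
  contDiffOn_L : ContDiffOn ℝ ∞ L U
  contDiffOn_m : ContDiffOn ℝ ∞ m U
  contDiffOn_v : ContDiffOn ℝ ∞ v U
  contDiffOn_e (A : Fin 2) : ContDiffOn ℝ ∞ (e A) U
  injective {y : E} (hy : y ∈ U) : Function.Injective (fderivWithin ℝ f U y)
  L_orthogonal {y : E} (hy : y ∈ U) (X : E) :
    G (f y) (fderivWithin ℝ f U y (L y)) (fderivWithin ℝ f U y X) = 0
  geodesic {y : E} (hy : y ∈ U) :
    localCov Γ f U (fun y ↦ fderivWithin ℝ f U y (L y)) y (L y) = 0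
  m_m {y : E} (hy : y ∈ U) : G (f y) (m y) (m y) = 0
  L_m {y : E} (hy : y ∈ U) : G (f y) (fderivWithin ℝ f U y (L y)) (m y) = -2
  e_m {y : E} (hy : y ∈ U) (A : Fin 2) : G (f y) (fderivWithin ℝ f U y (e A y)) (m y) = 0
  e_e {y : E} (hy : y ∈ U) (A B : Fin 2) :
    G (f y) (fderivWithin ℝ f U y (e A y)) (fderivWithin ℝ f U y (e B y)) = if A = B then 1 else 0
  v_e {y : E} (hy : y ∈ U) (A : Fin 2) : fderivWithin ℝ v U y (e A y) = 0
  lapse_pos {y : E} (hy : y ∈ U) : 0 < fderivWithin ℝ v U y (L y)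

namespace LocalNullFoliation

variable {G : F → F →L[ℝ] F →L[ℝ] ℝ} {Γ : F → F →L[ℝ] F →L[ℝ] F} {W : Set F}
  {U : Set E} {f : E → F} {L : E → E} {m : E → F} {v : E → ℝ} {e : Fin 2 → E → E}

theorem contDiffOn_push (h : LocalNullFoliation G Γ W U f L m v e) {X : E → E}
    (hX : ContDiffOn ℝ ∞ X U) : ContDiffOn ℝ ∞ (fun y ↦ fderivWithin ℝ f U y (X y)) U :=
  (h.contDiffOn_f.fderivWithin h.uniqueDiffOn (by simp)).clm_apply hX

theorem contDiffOn_cov (h : LocalNullFoliation G Γ W U f L m v e) {X : E → E} {Y : E → F}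
    (hX : ContDiffOn ℝ ∞ X U) (hY : ContDiffOn ℝ ∞ Y U) :
    ContDiffOn ℝ ∞ (fun y ↦ localCov Γ f U Y y (X y)) U :=
  contDiffOn_localCov h.uniqueDiffOn h.leviCivita.contDiffOn_symbol h.mapsTo h.contDiffOn_f hY hX

theorem contDiffOn_metric (h : LocalNullFoliation G Γ W U f L m v e) {Y Z : E → F}
    (hY : ContDiffOn ℝ ∞ Y U) (hZ : ContDiffOn ℝ ∞ Z U) :
    ContDiffOn ℝ ∞ (fun y ↦ G (f y) (Y y) (Z y)) U :=
  ((h.leviCivita.contDiffOn_metric.comp h.contDiffOn_f h.mapsTo).clm_apply hY).clm_apply hZ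

theorem fderivWithin_metric (h : LocalNullFoliation G Γ W U f L m v e) {Y Z : E → F}
    (hY : ContDiffOn ℝ ∞ Y U) (hZ : ContDiffOn ℝ ∞ Z U) {y : E} (hy : y ∈ U) (X : E) :
    fderivWithin ℝ (fun y ↦ G (f y) (Y y) (Z y)) U y X =
      G (f y) (localCov Γ f U Y y X) (Z y) + G (f y) (Y y) (localCov Γ f U Z y X) :=
  h.leviCivita.fderivWithin_metric (h.uniqueDiffOn y hy) (h.mapsTo hy)
    (h.contDiffOn_f.differentiableOn (by simp) y hy) (hY.differentiableOn (by simp) y hy)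
    (hZ.differentiableOn (by simp) y hy) X

/-- All scalar products in the null frame are constant, so the product rule moves a covariant
derivative from one frame vector to another at the price of a sign. -/
theorem metric_cov_of_const (h : LocalNullFoliation G Γ W U f L m v e) {Y Z : E → F}
    (hY : ContDiffOn ℝ ∞ Y U) (hZ : ContDiffOn ℝ ∞ Z U) {c : ℝ}
    (hc : ∀ y ∈ U, G (f y) (Y y) (Z y) = c) {y : E} (hy : y ∈ U) (X : E) :
    G (f y) (localCov Γ f U Y y X) (Z y) = - G (f y) (localCov Γ f U Z y X) (Y y) := by
  have h1 := h.fderivWithin_metric hY hZ hy X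
  rw [fderivWithin_congr (f := fun _ ↦ c) hc (hc y hy), fderivWithin_fun_const] at h1
  rw [h.leviCivita.metric_symm (h.mapsTo hy) (localCov Γ f U Z y X)]
  simp only [Pi.zero_apply, zero_apply] at h1
  linarith

theorem isNullFrame (h : LocalNullFoliation G Γ W U f L m v e) {y : E} (hy : y ∈ U) :
    IsNullFrame (G (f y)) (fun A ↦ fderivWithin ℝ f U y (e A y)) (fderivWithin ℝ f U y (L y))
      (m y) where
  symm := h.leviCivita.metric_symm (h.mapsTo hy)
  nondegenerate := h.leviCivita.nondegenerate (h.mapsTo hy)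
  e_e := h.e_e hy
  e_l A := by rw [h.leviCivita.metric_symm (h.mapsTo hy), h.L_orthogonal hy]
  e_m := h.e_m hy
  l_l := h.L_orthogonal hy _
  m_m := h.m_m hy
  l_m := h.L_m hy

/-- The expansion of a tangent vector in the frame `(e 0, e 1, L)`. -/
theorem tangent_expansion (h : LocalNullFoliation G Γ W U f L m v e) (hF : Module.finrank ℝ F = 4)
    {y : E} (hy : y ∈ U) (X : E) :
    X = ∑ B, G (f y) (fderivWithin ℝ f U y X) (fderivWithin ℝ f U y (e B y)) • e B y
      - (1 / 2 * G (f y) (fderivWithin ℝ f U y X) (m y)) • L y := by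
  apply h.injective hy
  conv_lhs => rw [(h.isNullFrame hy).expansion hF (fderivWithin ℝ f U y X)]
  have h0 : G (f y) (fderivWithin ℝ f U y X) (fderivWithin ℝ f U y (L y)) = 0 := by
    rw [h.leviCivita.metric_symm (h.mapsTo hy), h.L_orthogonal hy]
  simp [h0]

theorem torsion (h : LocalNullFoliation G Γ W U f L m v e) {X X' : E → E}
    (hX : ContDiffOn ℝ ∞ X U) (hX' : ContDiffOn ℝ ∞ X' U) {y : E} (hy : y ∈ U) :
    localCov Γ f U (fun y ↦ fderivWithin ℝ f U y (X' y)) y (X y)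
        - localCov Γ f U (fun y ↦ fderivWithin ℝ f U y (X y)) y (X' y) =
      fderivWithin ℝ f U y (fderivWithin ℝ X' U y (X y) - fderivWithin ℝ X U y (X' y)) :=
  h.leviCivita.localCov_torsion h.uniqueDiffOn h.subset_closure_interior hy (h.mapsTo hy)
    h.contDiffOn_f (hX.differentiableOn (by simp) y hy) (hX'.differentiableOn (by simp) y hy)

/-- Moving the derivative onto `e_B`, the difference of the two sides becomes the product of `L`
with the bracket of `e_A` and `e_B`. That bracket is tangent to the hypersurface, to which `L` is
normal. -/
theorem chi_symm (h : LocalNullFoliation G Γ W U f L m v e) {y : E} (hy : y ∈ U) (A B : Fin 2) :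
    G (f y) (localCov Γ f U (fun y ↦ fderivWithin ℝ f U y (L y)) y (e A y))
        (fderivWithin ℝ f U y (e B y)) =
      G (f y) (localCov Γ f U (fun y ↦ fderivWithin ℝ f U y (L y)) y (e B y))
        (fderivWithin ℝ f U y (e A y)) := by
  have hL := h.contDiffOn_push h.contDiffOn_L
  have he := fun A ↦ h.contDiffOn_push (h.contDiffOn_e A)
  rw [h.metric_cov_of_const hL (he B) (fun y hy ↦ h.L_orthogonal hy _) hy,
    h.metric_cov_of_const hL (he A) (fun y hy ↦ h.L_orthogonal hy _) hy, neg_inj,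
    ← sub_eq_zero, ← sub_apply, ← map_sub, h.torsion (h.contDiffOn_e A) (h.contDiffOn_e B) hy,
    h.leviCivita.metric_symm (h.mapsTo hy), h.L_orthogonal hy]

/-- Pairing with `m` detects the `L`-component of `[L, e_A]`, the part not tangent to the leaf. In
terms of the torsion coefficients its value is `-2η̲_A - 2ζ_A`. -/
theorem bracket_m (h : LocalNullFoliation G Γ W U f L m v e) {y : E} (hy : y ∈ U) (A : Fin 2) :
    G (f y) (fderivWithin ℝ f U y (fderivWithin ℝ (e A) U y (L y) - fderivWithin ℝ L U y (e A y)))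
        (m y) =
      - G (f y) (localCov Γ f U m y (L y)) (fderivWithin ℝ f U y (e A y))
      - G (f y) (localCov Γ f U (fun y ↦ fderivWithin ℝ f U y (L y)) y (e A y)) (m y) := by
  rw [← h.torsion h.contDiffOn_L (h.contDiffOn_e A) hy, map_sub, sub_apply,
    h.metric_cov_of_const (h.contDiffOn_push (h.contDiffOn_e A)) h.contDiffOn_m
      (fun y hy ↦ h.e_m hy A) hy]

/-- The relation `η̲ = - ζ - d log Ω` on the leaves. -/
theorem etabar_eq (h : LocalNullFoliation G Γ W U f L m v e) (hF : Module.finrank ℝ F = 4)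
    {y : E} (hy : y ∈ U) (A : Fin 2) :
    1 / 2 * G (f y) (localCov Γ f U m y (L y)) (fderivWithin ℝ f U y (e A y)) =
      - (1 / 2 * G (f y) (localCov Γ f U (fun y ↦ fderivWithin ℝ f U y (L y)) y (e A y)) (m y))
      - fderivWithin ℝ (fun y ↦ Real.log (fderivWithin ℝ v U y (L y))) U y (e A y) := by
  -- Compute `b v` for the bracket `b = [L, e_A]` in two ways. Since `e_A v = 0`, it is `-e_A(Ω)`;
  -- since only the `L`-component of `b` acts on `v`, it is `-½ g(b, m) Ω = (η̲_A + ζ_A) Ω`.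
  set b := fderivWithin ℝ (e A) U y (L y) - fderivWithin ℝ L U y (e A y) with hb
  have hm : G (f y) (fderivWithin ℝ f U y b) (m y) = _ := h.bracket_m hy A
  have hu := h.uniqueDiffOn y hy
  have hs : IsSymmSndFDerivWithinAt ℝ v U y := (h.contDiffOn_v y hy).isSymmSndFDerivWithinAt
    minSmoothness_two_le_infty h.uniqueDiffOn (h.subset_closure_interior hy) hy
  have hv2 := ((h.contDiffOn_v.fderivWithin (m := ∞) h.uniqueDiffOn (by simp)).differentiableOn
    (by simp) y hy).hasFDerivWithinAt
  have hΩ := hv2.clm_apply (h.contDiffOn_L.differentiableOn (by simp) y hy).hasFDerivWithinAt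
  have hve := hv2.clm_apply ((h.contDiffOn_e A).differentiableOn (by simp) y hy).hasFDerivWithinAt
  have e1 := congrArg (fun l : E →L[ℝ] ℝ ↦ l (L y)) (hve.fderivWithin hu)
  rw [fderivWithin_congr (f := fun _ ↦ 0) (fun y hy ↦ h.v_e hy A) (h.v_e hy A),
    fderivWithin_fun_const] at e1
  have e2 := congrArg (fderivWithin ℝ v U y) (h.tangent_expansion hF hy b)
  simp only [map_sub, map_sum, map_smul, h.v_e hy, hm] at e2
  rw [(hΩ.log (h.lapse_pos hy).ne').fderivWithin hu]
  rw [hb, map_sub] at e2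
  simp at e1 e2 ⊢
  rw [hs.eq] at e1
  have hp := h.lapse_pos hy
  field_simp
  linarith

/-- The transport equation for the trace of the conjugate null second fundamental form. -/
theorem transport (h : LocalNullFoliation G Γ W U f L m v e) (hF : Module.finrank ℝ F = 4)
    {y : E} (hy : y ∈ U) :
    fderivWithin ℝ (fun y ↦ ∑ A, G (f y) (localCov Γ f U m y (e A y))
        (fderivWithin ℝ f U y (e A y))) U y (L y) =
      2 * ∑ A, G (f y) (localCov Γ f U (fun y ↦ ∑ B, (1 / 2 * G (f y) (localCov Γ f U m y (L y))
          (fderivWithin ℝ f U y (e B y))) • fderivWithin ℝ f U y (e B y)) y (e A y))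
          (fderivWithin ℝ f U y (e A y))
        + ∑ A, G (f y) (localRiemann Γ (f y) (fderivWithin ℝ f U y (L y))
          (fderivWithin ℝ f U y (e A y)) (m y)) (fderivWithin ℝ f U y (e A y))
        - ∑ A, ∑ B,
          G (f y) (localCov Γ f U (fun y ↦ fderivWithin ℝ f U y (L y)) y (e A y))
            (fderivWithin ℝ f U y (e B y)) *
          G (f y) (localCov Γ f U m y (e A y)) (fderivWithin ℝ f U y (e B y))
        + 2 * ∑ A, (1 / 2 * G (f y) (localCov Γ f U m y (L y))
          (fderivWithin ℝ f U y (e A y))) ^ 2 := by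
  have hu := h.uniqueDiffOn y hy
  let pL := fun y ↦ fderivWithin ℝ f U y (L y)
  let pe : Fin 2 → E → F := fun A y ↦ fderivWithin ℝ f U y (e A y)
  have hL : ContDiffOn ℝ ∞ pL U := h.contDiffOn_push h.contDiffOn_L
  have he : ∀ A, ContDiffOn ℝ ∞ (pe A) U := fun A ↦ h.contDiffOn_push (h.contDiffOn_e A)
  let η : Fin 2 → E → ℝ := fun A y ↦ 1 / 2 * G (f y) (localCov Γ f U m y (L y)) (pe A y)
  have hηc : ∀ A, ContDiffOn ℝ ∞ (η A) U := fun A ↦ contDiffOn_const.mul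
    (h.contDiffOn_metric (h.contDiffOn_cov h.contDiffOn_L h.contDiffOn_m) (he A))
  -- `D_L m` is tangent to the leaves
  have hDLm : Set.EqOn (fun y ↦ localCov Γ f U m y (L y))
      (fun y ↦ (2 : ℝ) • ∑ B, η B y • pe B y) U := by
    intro y hy
    have h1 : G (f y) (localCov Γ f U m y (L y)) (m y) = 0 := by
      have := h.metric_cov_of_const h.contDiffOn_m h.contDiffOn_m (fun y hy ↦ h.m_m hy) hy (L y)
      linarith
    have h2 : G (f y) (localCov Γ f U m y (L y)) (pL y) = 0 := by
      have := h.metric_cov_of_const hL h.contDiffOn_m (fun y hy ↦ h.L_m hy) hy (L y)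
      rw [h.geodesic hy] at this
      simpa using this.symm
    change localCov Γ f U m y (L y) = _
    rw [(h.isNullFrame hy).expansion hF (localCov Γ f U m y (L y)), h1, h2]
    simp [η, pe, smul_smul]
  have hDADLm : ∀ A, G (f y) (localCov Γ f U (fun y ↦ localCov Γ f U m y (L y)) y (e A y)) (pe A y)
      = 2 * G (f y) (localCov Γ f U (fun y ↦ ∑ B, η B y • pe B y) y (e A y)) (pe A y) := by
    intro A
    rw [localCov_congr hy hDLm, localCov_const_smul hu]
    · simp
    · exact (ContDiffOn.sum fun B _ ↦ (hηc B).smul (he B)).differentiableOn (by simp) y hy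
  -- the components of the covariant derivatives of the frame
  let κ : Fin 2 → Fin 2 → ℝ := fun A B ↦ G (f y) (localCov Γ f U (pe A) y (L y)) (pe B y)
  -- `κ` is the infinitesimal rotation of the frame along `L`; it is skew because the frame stays
  -- orthonormal.
  have hκ : ∀ A B, κ A B = - κ B A := fun A B ↦
    h.metric_cov_of_const (he A) (he B) (fun y hy ↦ h.e_e hy A B) hy (L y)
  have hDLe : ∀ A, localCov Γ f U (pe A) y (L y) = ∑ B, κ A B • pe B y + η A y • pL y := by
    intro A
    have h1 : G (f y) (localCov Γ f U (pe A) y (L y)) (pL y) = 0 := by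
      have := h.metric_cov_of_const hL (he A) (fun y hy ↦ h.L_orthogonal hy _) hy (L y)
      rw [h.geodesic hy] at this
      simpa using this.symm
    have h2 : G (f y) (localCov Γ f U (pe A) y (L y)) (m y) = - 2 * η A y := by
      rw [h.metric_cov_of_const (he A) h.contDiffOn_m (fun y hy ↦ h.e_m hy A) hy (L y)]
      simp only [η]
      ring
    rw [(h.isNullFrame hy).expansion hF (localCov Γ f U (pe A) y (L y)), h1, h2]
    simp only [mul_zero, zero_smul, sub_zero, κ]
    module
  have hDAm : ∀ A, G (f y) (localCov Γ f U m y (e A y)) (pL y) =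
      - G (f y) (localCov Γ f U pL y (e A y)) (m y) := fun A ↦ by
    rw [h.metric_cov_of_const hL h.contDiffOn_m (fun y hy ↦ h.L_m hy) hy (e A y), neg_neg]
  -- The bracket `[L, e_A]` in coordinates. It is tangent to the hypersurface, so its components in
  -- the frame `(e_0, e_1, L)` determine `D_b m`.
  let b : Fin 2 → E := fun A ↦ fderivWithin ℝ (e A) U y (L y) - fderivWithin ℝ L U y (e A y)
  have hbe : ∀ A B, G (f y) (fderivWithin ℝ f U y (b A)) (pe B y) =
      κ A B - G (f y) (localCov Γ f U pL y (e A y)) (pe B y) := fun A B ↦ by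
    simp only [b]
    rw [← h.torsion h.contDiffOn_L (h.contDiffOn_e A) hy, map_sub, sub_apply]
  have hbm : ∀ A, G (f y) (fderivWithin ℝ f U y (b A)) (m y) =
      - 2 * η A y - G (f y) (localCov Γ f U pL y (e A y)) (m y) := fun A ↦ by
    simp only [b]
    rw [h.bracket_m hy A]
    simp only [η]
    ring
  have hDb : ∀ A, G (f y) (localCov Γ f U m y (b A)) (pe A y) =
      ∑ B, (κ A B - G (f y) (localCov Γ f U pL y (e A y)) (pe B y)) *
        G (f y) (localCov Γ f U m y (e B y)) (pe A y)
      + (2 * η A y + G (f y) (localCov Γ f U pL y (e A y)) (m y)) * η A y := by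
    intro A
    conv_lhs => rw [h.tangent_expansion hF hy (b A)]
    change G (f y) (localCov Γ f U m y
      (∑ B, G (f y) (fderivWithin ℝ f U y (b A)) (pe B y) • e B y
        - (1 / 2 * G (f y) (fderivWithin ℝ f U y (b A)) (m y)) • L y)) (pe A y) = _
    simp only [hbe, hbm, Fin.sum_univ_two, sub_eq_add_neg (_ + _ : E), ← neg_smul,
      localCov_add_right, localCov_smul_right, map_add, map_smul, add_apply, smul_apply,
      smul_eq_mul]
    have : G (f y) (localCov Γ f U m y (L y)) (pe A y) = 2 * η A y := by
      simp only [η]; ring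
    rw [this]
    ring
  -- The commutation `D_L D_A m = D_A D_L m + D_[L, e_A] m + R(L, e_A) m`, the source of both the
  -- divergence and the curvature term.
  have hcurv : ∀ A, G (f y) (localCov Γ f U (fun y ↦ localCov Γ f U m y (e A y)) y (L y)) (pe A y) =
      G (f y) (localCov Γ f U (fun y ↦ localCov Γ f U m y (L y)) y (e A y)) (pe A y)
      + G (f y) (localCov Γ f U m y (b A)) (pe A y)
      + G (f y) (localRiemann Γ (f y) (pL y) (pe A y) (m y)) (pe A y) := by
    intro A
    have := h.leviCivita.localCov_curvature h.uniqueDiffOn h.subset_closure_interior hy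
      (h.mapsTo hy) h.contDiffOn_f h.contDiffOn_m
      (h.contDiffOn_L.differentiableOn (by simp) y hy)
      ((h.contDiffOn_e A).differentiableOn (by simp) y hy)
    rw [← this]
    simp only [map_sub, sub_apply, b]
    ring
  have hterm : ∀ A, fderivWithin ℝ (fun y ↦ G (f y) (localCov Γ f U m y (e A y)) (pe A y)) U y (L y)
      = G (f y) (localCov Γ f U (fun y ↦ localCov Γ f U m y (e A y)) y (L y)) (pe A y)
        + G (f y) (localCov Γ f U m y (e A y)) (localCov Γ f U (pe A) y (L y)) := fun A ↦
    h.fderivWithin_metric (h.contDiffOn_cov (h.contDiffOn_e A) h.contDiffOn_m) (he A) hy (L y)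
  change fderivWithin ℝ (fun y ↦ ∑ A, G (f y) (localCov Γ f U m y (e A y)) (pe A y)) U y (L y) =
    2 * ∑ A, G (f y) (localCov Γ f U (fun y ↦ ∑ B, η B y • pe B y) y (e A y)) (pe A y)
      + ∑ A, G (f y) (localRiemann Γ (f y) (pL y) (pe A y) (m y)) (pe A y)
      - ∑ A, ∑ B, G (f y) (localCov Γ f U pL y (e A y)) (pe B y) *
          G (f y) (localCov Γ f U m y (e A y)) (pe B y)
      + 2 * ∑ A, η A y ^ 2
  have hsum : fderivWithin ℝ (fun y ↦ ∑ A, G (f y) (localCov Γ f U m y (e A y)) (pe A y)) U y =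
      ∑ A, fderivWithin ℝ (fun y ↦ G (f y) (localCov Γ f U m y (e A y)) (pe A y)) U y :=
    fderivWithin_fun_sum hu fun A _ ↦ (h.contDiffOn_metric (h.contDiffOn_cov (h.contDiffOn_e A)
      h.contDiffOn_m) (he A)).differentiableOn (by simp) y hy
  -- The bracket term gives the contraction of `χ` with the transpose of `χ̲`. Symmetry of `χ` turns
  -- it into `χ·χ̲`, so that of `χ̲` need not be established.
  have hχ : G (f y) (localCov Γ f U pL y (e 0 y)) (pe 1 y) =
      G (f y) (localCov Γ f U pL y (e 1 y)) (pe 0 y) := h.chi_symm hy 0 1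
  rw [hsum]
  simp only [sum_apply, hterm, hcurv, hDADLm, hDLe, hDb]
  simp only [Fin.sum_univ_two, map_add, map_smul, smul_eq_mul, hDAm]
  -- The rotation terms from `D_b m` and from `D_L e_A` cancel by skewness of `κ`. The `ζ` terms
  -- from the bracket and from the `L`-component of `D_L e_A` also cancel, leaving `2|η̲|²`.
  have w00 : κ 0 0 = 0 := by have := hκ 0 0; linarith
  have w11 : κ 1 1 = 0 := by have := hκ 1 1; linarith
  rw [w00, w11, hκ 1 0, hχ]
  ring

end LocalNullFoliation

end LocalNullFoliation

end

noncomputable section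

/-! ### The metric in a chart and its Levi-Civita symbol. -/

namespace LorentzMetric

variable {M : Type*} [TopologicalSpace M] [ChartedSpace R4 M] [IsManifold (𝓡 4) ∞ M]
  (g : LorentzMetric M)

/-- The coordinate vector fields are smooth sections, being images of constant sections under the
tangent map of the inverse chart; the entries of the matrix are the metric evaluated on them. -/
theorem contDiffOn_inChart (x₀ : M) :
    ContDiffOn ℝ ∞ (g.inChart x₀) (extChartAt (𝓡 4) x₀).target := by
  refine contDiffOn_clm_apply.mpr fun u ↦ contDiffOn_clm_apply.mpr fun w ↦ ?_
  have ho : IsOpen (extChartAt (𝓡 4) x₀).target := isOpen_extChartAt_target x₀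
  have hsymm : ContMDiffOn 𝓘(ℝ, R4) (𝓡 4) ∞ (extChartAt (𝓡 4) x₀).symm
      (extChartAt (𝓡 4) x₀).target := contMDiffOn_extChartAt_symm x₀
  have hsec : ∀ u : R4, ContMDiffOn 𝓘(ℝ, R4) (𝓡 4).tangent ∞
      (fun y ↦ (⟨(extChartAt (𝓡 4) x₀).symm y,
        mfderiv 𝓘(ℝ, R4) (𝓡 4) (extChartAt (𝓡 4) x₀).symm y u⟩ : TangentBundle (𝓡 4) M))
      (extChartAt (𝓡 4) x₀).target := by
    intro u
    have h1 := hsymm.contMDiffOn_tangentMapWithin (m := ∞) (by simp) ho.uniqueMDiffOn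
    have h2 : ContMDiff 𝓘(ℝ, R4) 𝓘(ℝ, R4).tangent ∞
        (fun y ↦ (⟨y, u⟩ : TangentBundle 𝓘(ℝ, R4) R4)) :=
      contMDiff_vectorSpace_iff_contDiff.mpr contDiff_const
    refine (h1.comp h2.contMDiffOn fun y hy ↦ hy).congr fun y hy ↦ ?_
    simp only [Function.comp, tangentMapWithin]
    rw [mfderivWithin_of_isOpen ho hy]
  have hg := g.contMDiff.comp_contMDiffOn hsymm
  have := ContMDiffOn.clm_bundle_apply₂ (E₃ := fun _ : M ↦ ℝ) (F₃ := ℝ) (IB := 𝓡 4)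
    (ψ := fun y ↦ g.inner ((extChartAt (𝓡 4) x₀).symm y)) hg (hsec u) (hsec w)
  rw [← contMDiffOn_iff_contDiffOn]
  intro y hy
  exact (contMDiffWithinAt_totalSpace.mp (this y hy)).2

theorem nondegenerate (x : M) (u : TangentSpace (𝓡 4) x) (hu : ∀ w, g.inner x u w = 0) :
    u = 0 := by
  obtain ⟨b, hb⟩ := g.signature x
  have hc : ∀ j, b.repr u j = 0 := by
    intro j
    have h1 := hu (b j)
    rw [← b.sum_repr u, map_sum, sum_apply] at h1
    simp only [map_smul, smul_apply, hb, smul_eq_mul, mul_ite, mul_zero,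
      Finset.sum_ite_eq', Finset.mem_univ, if_true] at h1
    split_ifs at h1 <;> linarith
  rw [← b.sum_repr u]
  simp [hc]

theorem mfderiv_extChartAt_symm (x₀ : M) {y : R4} (hy : y ∈ (extChartAt (𝓡 4) x₀).target) :
    mfderiv 𝓘(ℝ, R4) (𝓡 4) (extChartAt (𝓡 4) x₀).symm y =
      tangentCoordChange (𝓡 4) x₀ ((extChartAt (𝓡 4) x₀).symm y)
        ((extChartAt (𝓡 4) x₀).symm y) := by
  have hp : (extChartAt (𝓡 4) x₀).symm y ∈ (chartAt R4 x₀).source := by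
    rw [← extChartAt_source (𝓡 4)]
    exact (extChartAt (𝓡 4) x₀).map_target hy
  have h1 := TangentBundle.symmL_trivializationAt (I := 𝓡 4) hp
  rw [TangentBundle.symmL_trivializationAt_eq_core hp, (extChartAt (𝓡 4) x₀).right_inv hy] at h1
  rw [← mfderivWithin_univ]
  have h2 : Set.range (𝓡 4) = Set.univ := ModelWithCorners.range_eq_univ _
  rw [h2] at h1
  exact h1.symm

theorem inChart_apply (x₀ : M) {p : M} (hp : p ∈ (extChartAt (𝓡 4) x₀).source) (u w : R4) :
    g.inChart x₀ (extChartAt (𝓡 4) x₀ p) u w =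
      g.inner p (tangentCoordChange (𝓡 4) x₀ p p u) (tangentCoordChange (𝓡 4) x₀ p p w) := by
  have hy := (extChartAt (𝓡 4) x₀).map_source hp
  have h1 := mfderiv_extChartAt_symm x₀ hy
  simp only [inChart]
  rw [h1, (extChartAt (𝓡 4) x₀).left_inv hp]
  rfl

/-- A tangent vector at `p` is stored in the chart around `p` itself. This dictionary carries scalar
products to the fixed chart around `x₀`. -/
theorem inChart_tangentCoordChange (x₀ : M) {p : M} (hp : p ∈ (extChartAt (𝓡 4) x₀).source)
    (u w : R4) :
    g.inChart x₀ (extChartAt (𝓡 4) x₀ p) (tangentCoordChange (𝓡 4) p x₀ p u)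
      (tangentCoordChange (𝓡 4) p x₀ p w) = g.inner p u w := by
  have hpp := mem_extChartAt_source (I := 𝓡 4) p
  rw [g.inChart_apply x₀ hp, tangentCoordChange_comp ⟨⟨hpp, hp⟩, hpp⟩,
    tangentCoordChange_comp ⟨⟨hpp, hp⟩, hpp⟩, tangentCoordChange_self hpp,
    tangentCoordChange_self hpp]

theorem inChart_symm (x₀ : M) (y u w : R4) : g.inChart x₀ y u w = g.inChart x₀ y w u :=
  g.symm _ _ _

theorem inChart_nondegenerate (x₀ : M) {y : R4} (hy : y ∈ (extChartAt (𝓡 4) x₀).target) (u : R4)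
    (hu : ∀ w, g.inChart x₀ y u w = 0) : u = 0 := by
  obtain ⟨p, hp, rfl⟩ : ∃ p ∈ (extChartAt (𝓡 4) x₀).source, extChartAt (𝓡 4) x₀ p = y :=
    ⟨_, (extChartAt (𝓡 4) x₀).map_target hy, (extChartAt (𝓡 4) x₀).right_inv hy⟩
  have hpp := mem_extChartAt_source (I := 𝓡 4) p
  have h1 : tangentCoordChange (𝓡 4) x₀ p p u = 0 := by
    refine g.nondegenerate p _ fun (w : R4) ↦ ?_
    have := hu (tangentCoordChange (𝓡 4) p x₀ p w)
    rwa [g.inChart_apply x₀ hp, tangentCoordChange_comp ⟨⟨hpp, hp⟩, hpp⟩,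
      tangentCoordChange_self hpp] at this
  have h2 := tangentCoordChange_comp (I := 𝓡 4) (v := u) (z := p) (w := x₀) (x := p) (y := x₀)
    ⟨⟨hp, hpp⟩, hp⟩
  rw [h1, map_zero, tangentCoordChange_self hp] at h2
  exact h2.symm

/-- Nondegeneracy gives injectivity, and a space and its dual have equal finite dimension. Without
invertibility, the `inverse` in `christoffel` would take its default value `0`. -/
theorem inChart_isInvertible (x₀ : M) {y : R4} (hy : y ∈ (extChartAt (𝓡 4) x₀).target) :
    (g.inChart x₀ y).IsInvertible := by
  have hinj : Function.Injective (g.inChart x₀ y : R4 →ₗ[ℝ] (R4 →L[ℝ] ℝ)) := by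
    rw [injective_iff_map_eq_zero]
    intro u hu
    refine g.inChart_nondegenerate x₀ hy u fun w ↦ ?_
    exact congrArg (fun φ : R4 →L[ℝ] ℝ ↦ φ w) hu
  have hfr : Module.finrank ℝ R4 = Module.finrank ℝ (R4 →L[ℝ] ℝ) := by
    rw [← (LinearMap.toContinuousLinearMap (𝕜 := ℝ) (E := R4) (F' := ℝ)).finrank_eq]
    exact (Subspace.dual_finrank_eq (K := ℝ) (V := R4)).symm
  let e := (LinearMap.linearEquivOfInjective _ hinj hfr).toContinuousLinearEquiv
  exact ⟨e, by ext; rfl⟩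

/-- The Christoffel symbols in the preferred chart around `x₀`, as a bilinear map. -/
def symbol (x₀ : M) (y : R4) : R4 →L[ℝ] R4 →L[ℝ] R4 :=
  (ContinuousLinearMap.compL ℝ R4 (R4 →L[ℝ] ℝ) R4 (g.inChart x₀ y).inverse) ∘L
    ((1 / 2 : ℝ) • (fderiv ℝ (g.inChart x₀) y + (fderiv ℝ (g.inChart x₀) y).flip
      - (ContinuousLinearMap.flipₗᵢ ℝ R4 R4 ℝ : (R4 →L[ℝ] R4 →L[ℝ] ℝ) →L[ℝ] R4 →L[ℝ] R4 →L[ℝ] ℝ) ∘L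
        (fderiv ℝ (g.inChart x₀) y).flip))

theorem symbol_apply (x₀ : M) (y u w : R4) : g.symbol x₀ y u w = g.christoffel x₀ y u w := by
  simp [symbol, christoffel]

theorem inChart_symbol (x₀ : M) {y : R4} (hy : y ∈ (extChartAt (𝓡 4) x₀).target) (u w t : R4) :
    g.inChart x₀ y (g.symbol x₀ y u w) t =
      1 / 2 * (fderiv ℝ (g.inChart x₀) y u w t + fderiv ℝ (g.inChart x₀) y w u t
        - fderiv ℝ (g.inChart x₀) y t u w) := by
  rw [symbol_apply, christoffel, (g.inChart_isInvertible x₀ hy).self_apply_inverse]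
  simp

theorem fderiv_inChart_symm (x₀ : M) {y : R4} (hy : y ∈ (extChartAt (𝓡 4) x₀).target)
    (u w t : R4) :
    fderiv ℝ (g.inChart x₀) y u w t = fderiv ℝ (g.inChart x₀) y u t w := by
  have hd : HasFDerivAt (g.inChart x₀) (fderiv ℝ (g.inChart x₀) y) y :=
    (((g.contDiffOn_inChart x₀).contDiffAt
      ((isOpen_extChartAt_target x₀).mem_nhds hy)).differentiableAt (by simp)).hasFDerivAt
  have h1 : ∀ w t : R4, HasFDerivAt (fun y ↦ g.inChart x₀ y w t) _ y := fun w t ↦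
    (hd.clm_apply (hasFDerivAt_const w y)).clm_apply (hasFDerivAt_const t y)
  have h2 := h1 t w
  simp only [g.inChart_symm x₀ _ t w] at h2
  simpa using congrArg (fun l : R4 →L[ℝ] ℝ ↦ l u) ((h1 w t).unique h2)

/-- With the index lowered, the symbol is the Koszul expression of `inChart_symbol`. Symmetry of the
metric makes that expression symmetric in its first two slots, and adding it to its transpose in the
last two slots leaves one derivative of the metric. -/
theorem isLeviCivitaOn (x₀ : M) :
    IsLeviCivitaOn (g.inChart x₀) (g.symbol x₀) (extChartAt (𝓡 4) x₀).target where
  isOpen := isOpen_extChartAt_target x₀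
  contDiffOn_metric := g.contDiffOn_inChart x₀
  contDiffOn_symbol := by
    have ho : IsOpen (extChartAt (𝓡 4) x₀).target := isOpen_extChartAt_target x₀
    have hG := g.contDiffOn_inChart x₀
    have hd : ContDiffOn ℝ ∞ (fderiv ℝ (g.inChart x₀)) (extChartAt (𝓡 4) x₀).target :=
      hG.fderiv_of_isOpen ho (by simp)
    have hflip : ContDiffOn ℝ ∞ (fun y ↦ (fderiv ℝ (g.inChart x₀) y).flip)
        (extChartAt (𝓡 4) x₀).target :=
      (ContinuousLinearMap.flipₗᵢ ℝ R4 R4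
        (R4 →L[ℝ] ℝ)).toContinuousLinearEquiv.contDiff.comp_contDiffOn hd
    have hinv : ContDiffOn ℝ ∞ (fun y ↦ (g.inChart x₀ y).inverse)
        (extChartAt (𝓡 4) x₀).target := fun y hy ↦
      (g.inChart_isInvertible x₀ hy).contDiffAt_map_inverse.comp_contDiffWithinAt y (hG y hy)
    have hflip' : ContDiffOn ℝ ∞ (fun y ↦
        (ContinuousLinearMap.flipₗᵢ ℝ R4 R4 ℝ : (R4 →L[ℝ] R4 →L[ℝ] ℝ) →L[ℝ] R4 →L[ℝ] R4 →L[ℝ] ℝ) ∘L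
          (fderiv ℝ (g.inChart x₀) y).flip) (extChartAt (𝓡 4) x₀).target :=
      contDiffOn_const.clm_comp hflip
    have hsum := ((hd.add hflip).sub hflip').const_smul (1 / 2 : ℝ)
    have hcomp : ContDiffOn ℝ ∞
        (fun y ↦ ContinuousLinearMap.compL ℝ R4 (R4 →L[ℝ] ℝ) R4 (g.inChart x₀ y).inverse)
        (extChartAt (𝓡 4) x₀).target :=
      (ContinuousLinearMap.compL ℝ R4 (R4 →L[ℝ] ℝ) R4).contDiff.comp_contDiffOn hinv
    exact hcomp.clm_comp hsum
  metric_symm _ := g.inChart_symm x₀ _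
  nondegenerate hy := g.inChart_nondegenerate x₀ hy
  symbol_symm {y} hy u w := by
    refine sub_eq_zero.mp (g.inChart_nondegenerate x₀ hy _ fun t ↦ ?_)
    rw [map_sub, sub_apply, g.inChart_symbol x₀ hy, g.inChart_symbol x₀ hy,
      g.fderiv_inChart_symm x₀ hy t w u]
    ring
  compatible {y} hy u w t := by
    rw [g.inChart_symm x₀ y w, g.inChart_symbol x₀ hy, g.inChart_symbol x₀ hy,
      g.fderiv_inChart_symm x₀ hy u t w, g.fderiv_inChart_symm x₀ hy t u w,
      g.fderiv_inChart_symm x₀ hy w u t]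
    ring

theorem riemann_eq (x : M) (u w t : R4) :
    g.riemann x u w t = localRiemann (g.symbol x) (extChartAt (𝓡 4) x x) u w t := by
  have hd : HasFDerivAt (g.symbol x) _ (extChartAt (𝓡 4) x x) :=
    ((g.isLeviCivitaOn x).differentiableAt_symbol (mem_extChartAt_target x)).hasFDerivAt
  have h1 : ∀ u w : R4, fderiv ℝ (fun y ↦ g.christoffel x y w t) (extChartAt (𝓡 4) x x) u =
      fderiv ℝ (g.symbol x) (extChartAt (𝓡 4) x x) u w t := by
    intro u w
    simp only [← symbol_apply]
    rw [((hd.clm_apply (hasFDerivAt_const w _)).clm_apply (hasFDerivAt_const t _)).fderiv]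
    simp
  simp only [riemann, localRiemann, h1, symbol_apply]

/-- The invariant trace makes it possible to contract the vacuum equations in a null frame instead
of the coordinate basis. -/
theorem ricci_eq_trace (x : M) (u w : R4) (T : R4 →ₗ[ℝ] R4) (hT : ∀ z, T z = g.riemann x z u w) :
    g.ricci x u w = LinearMap.trace ℝ R4 T := by
  rw [LinearMap.trace_eq_matrix_trace ℝ (EuclideanSpace.basisFun (Fin 4) ℝ).toBasis, ricci]
  simp [Matrix.trace, LinearMap.toMatrix_apply, hT]

end LorentzMetric

end

noncomputable section

/-! ### Chart domains on a manifold with boundary. -/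

section ChartDomain

variable {E : Type*} [NormedAddCommGroup E] [NormedSpace ℝ E] {K : Type*} [TopologicalSpace K]
  {I : ModelWithCorners ℝ E K} {H : Type*} [TopologicalSpace H] [ChartedSpace K H]

/-- `U` is a relatively open subset of the target of the preferred chart around `q₀`. -/
structure IsChartDomain (I : ModelWithCorners ℝ E K) (q₀ : H) (U : Set E) : Prop where
  subset_target : U ⊆ (extChartAt I q₀).target
  mem_nhdsWithin {y : E} (hy : y ∈ U) : U ∈ nhdsWithin y (Set.range I)

namespace IsChartDomain

variable {q₀ : H} {U : Set E}

theorem subset_range (hU : IsChartDomain I q₀ U) : U ⊆ Set.range I :=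
  hU.subset_target.trans (extChartAt_target_subset_range q₀)

theorem uniqueDiffOn (hU : IsChartDomain I q₀ U) : UniqueDiffOn ℝ U := fun y hy ↦
  ((I.uniqueDiffOn y (hU.subset_range hy)).mono_nhds
    (nhdsWithin_le_iff.mpr (hU.mem_nhdsWithin hy)))

/-- The range of a model with corners lies in the closure of its interior, and this property passes
to relatively open subsets. It supplies symmetric second derivatives up to the boundary. -/
theorem subset_closure_interior (hU : IsChartDomain I q₀ U) : U ⊆ closure (interior U) := by
  intro y hy
  obtain ⟨O, hO, hyO, hOU⟩ := _root_.mem_nhdsWithin.mp (hU.mem_nhdsWithin hy)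
  have h1 : O ∩ interior (Set.range I) ⊆ interior U :=
    interior_maximal ((Set.inter_subset_inter_right O interior_subset).trans hOU)
      (hO.inter isOpen_interior)
  exact closure_mono h1 (hO.inter_closure
    ⟨hyO, I.range_subset_closure_interior (hU.subset_range hy)⟩)

theorem preimage_mem_nhds (hU : IsChartDomain I q₀ U) {q : H}
    (hq : q ∈ (extChartAt I q₀).source) (hqU : extChartAt I q₀ q ∈ U) :
    extChartAt I q₀ ⁻¹' U ∈ nhds q := by
  have h1 : Filter.Tendsto (extChartAt I q₀) (nhds q)
      (nhdsWithin (extChartAt I q₀ q) (Set.range I)) :=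
    tendsto_nhdsWithin_iff.mpr ⟨continuousAt_extChartAt' hq,
      Filter.Eventually.of_forall fun q' ↦ by simp [extChartAt]⟩
  exact h1 (hU.mem_nhdsWithin hqU)

theorem eventually (hU : IsChartDomain I q₀ U) {q : H}
    (hq : q ∈ (extChartAt I q₀).source) (hqU : extChartAt I q₀ q ∈ U) :
    ∀ᶠ q' in nhds q, q' ∈ (extChartAt I q₀).source ∧ extChartAt I q₀ q' ∈ U :=
  Filter.inter_mem (extChartAt_source_mem_nhds' hq) (hU.preimage_mem_nhds hq hqU)

end IsChartDomain

theorem mfderiv_extChartAt_eq_tangentCoordChange [IsManifold I 1 H] {q₀ q : H}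
    (hq : q ∈ (extChartAt I q₀).source) :
    mfderiv I 𝓘(ℝ, E) (extChartAt I q₀) q = tangentCoordChange I q q₀ q := by
  have hq' : q ∈ (chartAt K q₀).source := by rwa [← extChartAt_source I]
  rw [← TangentBundle.continuousLinearMapAt_trivializationAt hq',
    TangentBundle.continuousLinearMapAt_trivializationAt_eq_core hq']

/-- The manifold derivative of a function, computed in a chart. -/
theorem IsChartDomain.hasMFDerivAt [IsManifold I 1 H] {q₀ : H} {U : Set E}
    (hU : IsChartDomain I q₀ U) {V : Type*} [NormedAddCommGroup V] [NormedSpace ℝ V]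
    {h : H → V} {h' : E → V} {q : H} (hq : q ∈ (extChartAt I q₀).source)
    (hqU : extChartAt I q₀ q ∈ U)
    (hd : DifferentiableWithinAt ℝ h' U (extChartAt I q₀ q))
    (heq : ∀ᶠ q' in nhds q, h q' = h' (extChartAt I q₀ q')) :
    HasMFDerivAt I 𝓘(ℝ, V) h q
      (fderivWithin ℝ h' U (extChartAt I q₀ q) ∘L tangentCoordChange I q q₀ q : E →L[ℝ] V) := by
  have hq' : q ∈ (chartAt K q₀).source := by rwa [← extChartAt_source I]
  have h1 : HasMFDerivWithinAt 𝓘(ℝ, E) 𝓘(ℝ, V) h' U (extChartAt I q₀ q) _ :=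
    hd.hasFDerivWithinAt.hasMFDerivWithinAt
  have h2 : HasMFDerivAt I 𝓘(ℝ, E) (extChartAt I q₀) q _ :=
    (mdifferentiableAt_extChartAt hq').hasMFDerivAt
  have h3 := (h1.comp q h2.hasMFDerivWithinAt subset_rfl).hasMFDerivAt
    (hU.preimage_mem_nhds hq hqU)
  rw [mfderiv_extChartAt_eq_tangentCoordChange hq] at h3
  exact h3.congr_of_eventuallyEq heq

end ChartDomain

/-! ### Change of chart for Christoffel symbols and covariant derivatives. -/

namespace LorentzMetric

variable {M : Type*} [TopologicalSpace M] [ChartedSpace R4 M] [IsManifold (𝓡 4) ∞ M]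
  (g : LorentzMetric M)

theorem fderiv_extChartAt_comp_symm (x₀ x₁ p : M) :
    fderiv ℝ (extChartAt (𝓡 4) x₁ ∘ (extChartAt (𝓡 4) x₀).symm) (extChartAt (𝓡 4) x₀ p) =
      tangentCoordChange (𝓡 4) x₀ x₁ p := by
  have h2 : Set.range (𝓡 4) = Set.univ := ModelWithCorners.range_eq_univ _
  rw [tangentCoordChange_def, h2, fderivWithin_univ]

theorem contDiffAt_extChartAt_comp_symm (x₀ x₁ : M) {p : M}
    (hp₀ : p ∈ (extChartAt (𝓡 4) x₀).source) (hp₁ : p ∈ (extChartAt (𝓡 4) x₁).source) :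
    ContDiffAt ℝ ∞ (extChartAt (𝓡 4) x₁ ∘ (extChartAt (𝓡 4) x₀).symm)
      (extChartAt (𝓡 4) x₀ p) := by
  have h2 : Set.range (𝓡 4) = Set.univ := ModelWithCorners.range_eq_univ _
  have h3 := contDiffWithinAt_ext_coord_change (I := 𝓡 4) (n := ∞) x₁ x₀
    (y := extChartAt (𝓡 4) x₀ p) (by
      rw [PartialEquiv.trans_source'', PartialEquiv.symm_symm, PartialEquiv.symm_target]
      exact Set.mem_image_of_mem _ ⟨hp₀, hp₁⟩)
  rwa [h2, contDiffWithinAt_univ] at h3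

/-- The transformation law of the Christoffel symbols between two preferred charts. -/
theorem symbol_tangentCoordChange (x₀ x₁ : M) {p : M}
    (hp₀ : p ∈ (extChartAt (𝓡 4) x₀).source) (hp₁ : p ∈ (extChartAt (𝓡 4) x₁).source) (u w : R4) :
    g.symbol x₁ (extChartAt (𝓡 4) x₁ p) (tangentCoordChange (𝓡 4) x₀ x₁ p u)
        (tangentCoordChange (𝓡 4) x₀ x₁ p w)
      + fderiv ℝ (fderiv ℝ (extChartAt (𝓡 4) x₁ ∘ (extChartAt (𝓡 4) x₀).symm))
          (extChartAt (𝓡 4) x₀ p) u w =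
      tangentCoordChange (𝓡 4) x₀ x₁ p (g.symbol x₀ (extChartAt (𝓡 4) x₀ p) u w) := by
  have hz := (extChartAt (𝓡 4) x₀).map_source hp₀
  have hθ : (extChartAt (𝓡 4) x₁ ∘ (extChartAt (𝓡 4) x₀).symm) (extChartAt (𝓡 4) x₀ p) =
      extChartAt (𝓡 4) x₁ p := by
    simp only [Function.comp, (extChartAt (𝓡 4) x₀).left_inv hp₀]
  have := (g.isLeviCivitaOn x₀).symbol_change (g.isLeviCivitaOn x₁) hz
    (ψ := extChartAt (𝓡 4) x₁ ∘ (extChartAt (𝓡 4) x₀).symm)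
    (by rw [hθ]; exact (extChartAt (𝓡 4) x₁).map_source hp₁)
    (contDiffAt_extChartAt_comp_symm x₀ x₁ hp₀ hp₁) ?_ ?_ u w
  · rwa [hθ, fderiv_extChartAt_comp_symm] at this
  · intro w
    refine ⟨tangentCoordChange (𝓡 4) x₁ x₀ p w, ?_⟩
    rw [fderiv_extChartAt_comp_symm, tangentCoordChange_comp ⟨⟨hp₁, hp₀⟩, hp₁⟩,
      tangentCoordChange_self hp₁]
  · have hc : ContinuousAt (extChartAt (𝓡 4) x₀).symm (extChartAt (𝓡 4) x₀ p) :=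
      continuousAt_extChartAt_symm' hp₀
    have h1 : (extChartAt (𝓡 4) x₁).source ∈
        nhds ((extChartAt (𝓡 4) x₀).symm (extChartAt (𝓡 4) x₀ p)) := by
      rw [(extChartAt (𝓡 4) x₀).left_inv hp₀]
      exact extChartAt_source_mem_nhds' hp₁
    filter_upwards [(isOpen_extChartAt_target x₀).mem_nhds hz, hc h1] with z hz hz₁ u w
    obtain ⟨p', hp', rfl⟩ : ∃ p' ∈ (extChartAt (𝓡 4) x₀).source, extChartAt (𝓡 4) x₀ p' = z :=
      ⟨_, (extChartAt (𝓡 4) x₀).map_target hz, (extChartAt (𝓡 4) x₀).right_inv hz⟩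
    have hz₁ : p' ∈ (extChartAt (𝓡 4) x₁).source := by
      have := Set.mem_preimage.mp hz₁
      rwa [(extChartAt (𝓡 4) x₀).left_inv hp'] at this
    have hpp := mem_extChartAt_source (I := 𝓡 4) p'
    rw [fderiv_extChartAt_comp_symm, Function.comp, (extChartAt (𝓡 4) x₀).left_inv hp',
      g.inChart_apply x₀ hp', g.inChart_apply x₁ hz₁,
      tangentCoordChange_comp ⟨⟨hp', hz₁⟩, hpp⟩, tangentCoordChange_comp ⟨⟨hp', hz₁⟩, hpp⟩]

section Along

variable {E : Type*} [NormedAddCommGroup E] [NormedSpace ℝ E] {K : Type*} [TopologicalSpace K]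
  {I : ModelWithCorners ℝ E K} {H : Type*} [TopologicalSpace H] [ChartedSpace K H]
  [IsManifold I 1 H] {q₀ : H} {U : Set E} {ι : H → M} {x₀ : M} {f : E → R4}

/-- The derivative of a map to `M`, computed in charts. -/
theorem tangentCoordChange_mfderiv (hU : IsChartDomain I q₀ U) {q : H}
    (hq : q ∈ (extChartAt I q₀).source) (hqU : extChartAt I q₀ q ∈ U)
    (hι : MDifferentiableAt I (𝓡 4) ι q) (hιq : ι q ∈ (extChartAt (𝓡 4) x₀).source)
    (hf : DifferentiableWithinAt ℝ f U (extChartAt I q₀ q))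
    (hfι : ∀ᶠ q' in nhds q, extChartAt (𝓡 4) x₀ (ι q') = f (extChartAt I q₀ q'))
    (X : TangentSpace I q) :
    tangentCoordChange (𝓡 4) (ι q) x₀ (ι q) (mfderiv I (𝓡 4) ι q X) =
      fderivWithin ℝ f U (extChartAt I q₀ q) (tangentCoordChange I q q₀ q X) := by
  have hιq' : ι q ∈ (chartAt R4 x₀).source := by rwa [← extChartAt_source (𝓡 4)]
  have h1 := hU.hasMFDerivAt hq hqU hf hfι
  have h2 : HasMFDerivAt (𝓡 4) 𝓘(ℝ, R4) (extChartAt (𝓡 4) x₀) (ι q) _ :=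
    (mdifferentiableAt_extChartAt hιq').hasMFDerivAt
  rw [mfderiv_extChartAt_eq_tangentCoordChange hιq] at h2
  have h3 := (h2.comp q hι.hasMFDerivAt)
  have h4 := hasMFDerivAt_unique h3 h1
  exact congrArg (fun l : E →L[ℝ] R4 ↦ l X) h4

/-- The covariant derivative along a map to `M`, computed in charts. -/
theorem tangentCoordChange_covAlong (hU : IsChartDomain I q₀ U) {q : H}
    (hq : q ∈ (extChartAt I q₀).source) (hqU : extChartAt I q₀ q ∈ U)
    (hι : MDifferentiableAt I (𝓡 4) ι q) (hιq : ι q ∈ (extChartAt (𝓡 4) x₀).source)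
    (hf : DifferentiableWithinAt ℝ f U (extChartAt I q₀ q))
    (hfι : ∀ᶠ q' in nhds q, extChartAt (𝓡 4) x₀ (ι q') = f (extChartAt I q₀ q'))
    {Y : (q : H) → TangentSpace (𝓡 4) (ι q)} {Y' : E → R4}
    (hY' : DifferentiableWithinAt ℝ Y' U (extChartAt I q₀ q))
    (hY : ∀ᶠ q' in nhds q,
      tangentCoordChange (𝓡 4) (ι q') x₀ (ι q') (Y q') = Y' (extChartAt I q₀ q'))
    (X : TangentSpace I q) :
    tangentCoordChange (𝓡 4) (ι q) x₀ (ι q) (g.covAlong I ι Y q X) =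
      localCov (g.symbol x₀) f U Y' (extChartAt I q₀ q) (tangentCoordChange I q q₀ q X) := by
  have hιq₁ : ι q ∈ (extChartAt (𝓡 4) (ι q)).source := mem_extChartAt_source (ι q)
  set θ := extChartAt (𝓡 4) (ι q) ∘ (extChartAt (𝓡 4) x₀).symm with hθ
  have hfq : f (extChartAt I q₀ q) = extChartAt (𝓡 4) x₀ (ι q) := hfι.self_of_nhds.symm
  have hθ2 : HasFDerivAt (fderiv ℝ θ) (fderiv ℝ (fderiv ℝ θ) (f (extChartAt I q₀ q)))
      (f (extChartAt I q₀ q)) := by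
    rw [hfq]
    exact (((contDiffAt_extChartAt_comp_symm x₀ (ι q) hιq hιq₁).fderiv_right (m := ∞)
      (by simp)).differentiableAt (by simp)).hasFDerivAt
  -- In the chart around `ι q`, the field is `dθ` applied to its representative `Y'` in the chart
  -- around `x₀`. Its derivative therefore contains a second derivative of the transition map `θ`.
  have hrep : HasFDerivWithinAt (fun y ↦ fderiv ℝ θ (f y) (Y' y)) _ U (extChartAt I q₀ q) :=
    (hθ2.comp_hasFDerivWithinAt _ hf.hasFDerivWithinAt).clm_apply hY'.hasFDerivWithinAt
  let Yc : H → R4 := fun q' ↦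
    (trivializationAt R4 (TangentSpace (𝓡 4) : M → Type _) (ι q)
      (⟨ι q', Y q'⟩ : TangentBundle (𝓡 4) M)).2
  have hYc : ∀ᶠ q' in nhds q, Yc q' = (fun y ↦ fderiv ℝ θ (f y) (Y' y)) (extChartAt I q₀ q') := by
    filter_upwards [hfι, hY, hι.continuousAt (extChartAt_source_mem_nhds' hιq),
      hι.continuousAt (extChartAt_source_mem_nhds (I := 𝓡 4) (ι q))] with q' h1 h2 h3 h4
    have hpp := mem_extChartAt_source (I := 𝓡 4) (ι q')
    rw [← h1, ← h2, hθ, fderiv_extChartAt_comp_symm]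
    exact (tangentCoordChange_comp (I := 𝓡 4) (v := (Y q' : R4)) ⟨⟨hpp, h3⟩, h4⟩).symm
  let dYc : E →L[ℝ] R4 := mfderiv I 𝓘(ℝ, R4) Yc q
  have hd : dYc = _ :=
    (hU.hasMFDerivAt hq hqU hrep.differentiableWithinAt hYc).mfderiv
  let X' : E := tangentCoordChange I q q₀ q X
  let dι : R4 := mfderiv I (𝓡 4) ι q X
  let Yq : R4 := Y q
  have hdι : tangentCoordChange (𝓡 4) (ι q) x₀ (ι q) dι =
      fderivWithin ℝ f U (extChartAt I q₀ q) X' :=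
    tangentCoordChange_mfderiv hU hq hqU hι hιq hf hfι X
  have hYq : tangentCoordChange (𝓡 4) (ι q) x₀ (ι q) Yq = Y' (extChartAt I q₀ q) :=
    hY.self_of_nhds
  have hback : ∀ w : R4, tangentCoordChange (𝓡 4) x₀ (ι q) (ι q)
      (tangentCoordChange (𝓡 4) (ι q) x₀ (ι q) w) = w := fun w ↦ by
    rw [tangentCoordChange_comp ⟨⟨hιq₁, hιq⟩, hιq₁⟩, tangentCoordChange_self hιq₁]
  have hforth : ∀ w : R4, tangentCoordChange (𝓡 4) (ι q) x₀ (ι q)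
      (tangentCoordChange (𝓡 4) x₀ (ι q) (ι q) w) = w := fun w ↦ by
    rw [tangentCoordChange_comp ⟨⟨hιq, hιq₁⟩, hιq⟩, tangentCoordChange_self hιq]
  have hθ1 : fderiv ℝ θ (f (extChartAt I q₀ q)) = tangentCoordChange (𝓡 4) x₀ (ι q) (ι q) := by
    rw [hfq, hθ, fderiv_extChartAt_comp_symm]
  have hcov : (g.covAlong I ι Y q X : R4) = dYc X
      + g.symbol (ι q) (extChartAt (𝓡 4) (ι q) (ι q)) dι Yq := by
    rw [symbol_apply]
    rfl
  have hdY : dYc X = tangentCoordChange (𝓡 4) x₀ (ι q) (ι q)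
        (fderivWithin ℝ Y' U (extChartAt I q₀ q) X')
      + fderiv ℝ (fderiv ℝ θ) (f (extChartAt I q₀ q)) (fderivWithin ℝ f U (extChartAt I q₀ q) X')
        (Y' (extChartAt I q₀ q)) := by
    rw [hd, hrep.fderivWithin (hU.uniqueDiffOn _ hqU), ← hθ1]
    rfl
  -- The inhomogeneous term in the transformation law of the symbol absorbs exactly that second
  -- derivative of `θ`.
  have hsym := g.symbol_tangentCoordChange x₀ (ι q) hιq hιq₁
    (fderivWithin ℝ f U (extChartAt I q₀ q) X') (Y' (extChartAt I q₀ q))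
  rw [← hdι, hback, ← hYq, hback, hdι, hYq, ← hfq, ← hθ] at hsym
  refine (congrArg (tangentCoordChange (𝓡 4) (ι q) x₀ (ι q)) hcov).trans ?_
  rw [hdY, add_assoc, add_comm (fderiv ℝ (fderiv ℝ θ) _ _ _), hsym, ← map_add, hforth]
  rfl

end Along

end LorentzMetric

end

noncomputable section

/-! ### Orthonormal frames and contractions. -/

section Frames

variable {E : Type*} [NormedAddCommGroup E] [NormedSpace ℝ E]

theorem ContDiffOn.bilinearComp [FiniteDimensional ℝ E] {F E' : Type*} [NormedAddCommGroup F]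
    [NormedSpace ℝ F] [NormedAddCommGroup E'] [NormedSpace ℝ E'] {U : Set E'}
    {G : E' → F →L[ℝ] F →L[ℝ] ℝ} {A : E' → E →L[ℝ] F} (hG : ContDiffOn ℝ ∞ G U)
    (hA : ContDiffOn ℝ ∞ A U) :
    ContDiffOn ℝ ∞ (fun y ↦ (G y).bilinearComp (A y) (A y)) U :=
  contDiffOn_clm_apply.mpr fun _ ↦ contDiffOn_clm_apply.mpr fun _ ↦
    (hG.clm_apply (hA.clm_apply contDiffOn_const)).clm_apply (hA.clm_apply contDiffOn_const)

/-- An orthonormal basis of the kernel of `η` at one point extends to a smooth orthonormal frame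
of the kernel near that point. -/
theorem exists_orthonormal_frame {U : Set E} {y₀ : E} (hy₀ : y₀ ∈ U) {B : E → E →L[ℝ] E →L[ℝ] ℝ}
    {η : E → E →L[ℝ] ℝ} {L : E → E} (hB : ContDiffOn ℝ ∞ B U) (hη : ContDiffOn ℝ ∞ η U)
    (hL : ContDiffOn ℝ ∞ L U) (hsymm : ∀ y ∈ U, ∀ u w, B y u w = B y w u)
    (hηL : ∀ y ∈ U, η y (L y) ≠ 0) (a : Fin 2 → E) (hηa : ∀ A, η y₀ (a A) = 0)
    (hBa : ∀ A A', B y₀ (a A) (a A') = if A = A' then 1 else 0) :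
    ∃ (V : Set E) (e : Fin 2 → E → E), IsOpen V ∧ y₀ ∈ V ∧
      (∀ A, ContDiffOn ℝ ∞ (e A) (U ∩ V)) ∧ (∀ A, e A y₀ = a A) ∧
      ∀ y ∈ U ∩ V, (∀ A, η y (e A y) = 0) ∧
        ∀ A A', B y (e A y) (e A' y) = if A = A' then 1 else 0 := by
  -- Project the constant fields `a A` to the kernel of `η` along `L`, which is transversal to it;
  -- then apply Gram-Schmidt.
  let X : Fin 2 → E → E := fun A y ↦ a A - (η y (a A) / η y (L y)) • L y
  have hX : ∀ A, ContDiffOn ℝ ∞ (X A) U := fun A ↦ contDiffOn_const.sub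
    (((hη.clm_apply contDiffOn_const).div (hη.clm_apply hL) hηL).smul hL)
  have hηX : ∀ y ∈ U, ∀ A, η y (X A y) = 0 := by
    intro y hy A
    have := hηL y hy
    simp only [X, map_sub, map_smul, smul_eq_mul]
    field_simp
    ring
  have hX₀ : ∀ A, X A y₀ = a A := fun A ↦ by simp [X, hηa]
  let b : Fin 2 → Fin 2 → E → ℝ := fun A A' y ↦ B y (X A y) (X A' y)
  have hb : ∀ A A', ContDiffOn ℝ ∞ (b A A') U := fun A A' ↦ (hB.clm_apply (hX A)).clm_apply (hX A')
  -- The Gram-Schmidt vector multiplied by `b 0 0`, so that it is smooth on all of `U`. Division is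
  -- postponed to the neighbourhood `V` on which both square norms are positive.
  let Z : E → E := fun y ↦ b 0 0 y • X 1 y - b 0 1 y • X 0 y
  have hZ : ContDiffOn ℝ ∞ Z U := ((hb 0 0).smul (hX 1)).sub ((hb 0 1).smul (hX 0))
  let n : E → ℝ := fun y ↦ B y (Z y) (Z y)
  have hn : ContDiffOn ℝ ∞ n U := (hB.clm_apply hZ).clm_apply hZ
  have hb₀ : ∀ A A', b A A' y₀ = if A = A' then 1 else 0 := fun A A' ↦ by simp [b, hX₀, hBa]
  have hZ₀ : Z y₀ = a 1 := by simp [Z, hb₀, hX₀]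
  have hn₀ : n y₀ = 1 := by simp [n, hZ₀, hBa]
  have hev : ∀ᶠ y in nhdsWithin y₀ U, 0 < b 0 0 y ∧ 0 < n y :=
    ((((hb 0 0).continuousOn y₀ hy₀).eventually (lt_mem_nhds (by simp [hb₀]))).and
      ((hn.continuousOn y₀ hy₀).eventually (lt_mem_nhds (by simp [hn₀]))))
  obtain ⟨V, hV, hyV, hVU⟩ := mem_nhdsWithin.mp hev
  have hpos : ∀ y ∈ U ∩ V, 0 < b 0 0 y ∧ 0 < n y := fun y hy ↦ hVU ⟨hy.2, hy.1⟩
  let e : Fin 2 → E → E := ![fun y ↦ (√(b 0 0 y))⁻¹ • X 0 y, fun y ↦ (√(n y))⁻¹ • Z y]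
  refine ⟨V, e, hV, hyV, ?_, ?_, ?_⟩
  · have hle : U ∩ V ⊆ U := Set.inter_subset_left
    refine Fin.forall_fin_two.mpr ⟨?_, ?_⟩
    · exact (((hb 0 0).mono hle |>.sqrt fun y hy ↦ (hpos y hy).1.ne').inv
        fun y hy ↦ (Real.sqrt_pos.mpr (hpos y hy).1).ne').smul ((hX 0).mono hle)
    · exact ((hn.mono hle |>.sqrt fun y hy ↦ (hpos y hy).2.ne').inv
        fun y hy ↦ (Real.sqrt_pos.mpr (hpos y hy).2).ne').smul (hZ.mono hle)
  · exact Fin.forall_fin_two.mpr ⟨by simp [e, hb₀, hX₀], by simp [e, hn₀, hZ₀]⟩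
  · intro y hy
    obtain ⟨h0, h1⟩ := hpos y hy
    have hs0 : √(b 0 0 y) * √(b 0 0 y) = b 0 0 y := Real.mul_self_sqrt h0.le
    have hs1 : √(n y) * √(n y) = n y := Real.mul_self_sqrt h1.le
    have hs0' := (Real.sqrt_pos.mpr h0).ne'
    have hs1' := (Real.sqrt_pos.mpr h1).ne'
    have hXZ : B y (X 0 y) (Z y) = 0 := by
      simp only [Z, map_sub, map_smul, smul_eq_mul]
      change b 0 0 y * b 0 1 y - b 0 1 y * b 0 0 y = 0
      ring
    have hZX : B y (Z y) (X 0 y) = 0 := by rw [hsymm y hy.1, hXZ]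
    have hXX : B y (X 0 y) (X 0 y) = √(b 0 0 y) * √(b 0 0 y) := hs0.symm
    have hZZ : B y (Z y) (Z y) = √(n y) * √(n y) := hs1.symm
    refine ⟨Fin.forall_fin_two.mpr ⟨by simp [e, hηX y hy.1], by simp [e, Z, hηX y hy.1]⟩, ?_⟩
    refine Fin.forall_fin_two.mpr ⟨Fin.forall_fin_two.mpr ⟨?_, ?_⟩,
      Fin.forall_fin_two.mpr ⟨?_, ?_⟩⟩
    · simp [e, hXX, hs0']
    · simp [e, hXZ]
    · simp [e, hZX]
    · simp [e, hZZ, hs1']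

/-- A symmetric bilinear form on a `3`-dimensional space that is positive on the kernel of a
nonzero linear form has an orthonormal basis of that kernel. -/
theorem exists_orthonormal_of_posDef (hE : Module.finrank ℝ E = 3) (B : E →ₗ[ℝ] E →ₗ[ℝ] ℝ)
    (η : E →ₗ[ℝ] ℝ) (hη : η ≠ 0) (hsymm : ∀ u w, B u w = B w u)
    (hpos : ∀ u, η u = 0 → u ≠ 0 → 0 < B u u) :
    ∃ a : Fin 2 → E, (∀ A, η (a A) = 0) ∧
      ∀ A A', B (a A) (a A') = if A = A' then 1 else 0 := by
  have : FiniteDimensional ℝ E := .of_finrank_pos (by omega)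
  have hker : Module.finrank ℝ η.ker = 2 := by
    have h1 := LinearMap.finrank_range_add_finrank_ker η
    rw [LinearMap.range_eq_top.mpr (LinearMap.surjective hη), finrank_top, hE,
      Module.finrank_self] at h1
    omega
  let c := Module.finBasisOfFinrankEq ℝ η.ker hker
  have hc : ∀ A, η (c A : E) = 0 := fun A ↦ (c A).2
  have hli : LinearIndependent ℝ (fun A ↦ (c A : E)) :=
    c.linearIndependent.map' η.ker.subtype (Submodule.ker_subtype _)
  have hx : (c 0 : E) ≠ 0 := hli.ne_zero 0
  set x : E := (c 0 : E)
  let z : E := (c 1 : E) - (B x (c 1) / B x x) • x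
  have hηx : η x = 0 := hc 0
  have hηz : η z = 0 := by simp [z, hc, hηx]
  have hz : z ≠ 0 := by
    intro h0
    have := Fintype.linearIndependent_iff.mp hli ![-(B x (c 1) / B x x), 1] (by
      simp only [Fin.sum_univ_two, Matrix.cons_val_zero, Matrix.cons_val_one]
      rw [← h0]
      simp only [z, x]
      module) 1
    simp at this
  have px := hpos x hηx hx
  have pz := hpos z hηz hz
  have hxz : B x z = 0 := by
    simp only [z, map_sub, map_smul, smul_eq_mul]
    field_simp
    ring
  have hzx : B z x = 0 := by rw [hsymm, hxz]
  have sx := Real.mul_self_sqrt px.le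
  have sz := Real.mul_self_sqrt pz.le
  have sx' := (Real.sqrt_pos.mpr px).ne'
  have sz' := (Real.sqrt_pos.mpr pz).ne'
  refine ⟨![(√(B x x))⁻¹ • x, (√(B z z))⁻¹ • z],
    Fin.forall_fin_two.mpr ⟨by simp [hηx], by simp [hηz]⟩,
    Fin.forall_fin_two.mpr ⟨Fin.forall_fin_two.mpr ⟨?_, ?_⟩, Fin.forall_fin_two.mpr ⟨?_, ?_⟩⟩⟩
  · simp
    field_simp
    nlinarith
  · simp [hxz]
  · simp [hzx]
  · simp
    field_simp
    nlinarith

/-- Contractions do not depend on the choice of the orthonormal basis. -/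
theorem sum_contraction_eq {V : Type*} [AddCommGroup V] [Module ℝ V] {E : Type*} [AddCommGroup E]
    [Module ℝ E] {s : E → E → ℝ} (hs : ∀ u w, s u w = s w u) {e e' : Fin 2 → E}
    (he : ∀ A, e A = ∑ B, s (e A) (e' B) • e' B) (he' : ∀ A, e' A = ∑ B, s (e' A) (e B) • e B)
    (T : E →ₗ[ℝ] E →ₗ[ℝ] V) :
    ∑ A, T (e A) (e A) = ∑ A, T (e' A) (e' A) := by
  calc ∑ A, T (e A) (e A) = ∑ A, ∑ B, s (e A) (e' B) • T (e' B) (e A) := by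
        refine Finset.sum_congr rfl fun A _ ↦ ?_
        conv_lhs => enter [1]; rw [he A]
        simp
    _ = ∑ B, ∑ A, s (e A) (e' B) • T (e' B) (e A) := Finset.sum_comm
    _ = ∑ B, T (e' B) (e' B) := by
        refine Finset.sum_congr rfl fun B _ ↦ ?_
        conv_rhs => enter [2]; rw [he' B]
        simp [hs (e' B)]

end Frames

/-- If `u` were not spacelike, the Cauchy-Schwarz inequality for the spatial parts would give `(u₀
t₀)² ≤ u₀² |t'|²` with `t'` the spatial part of `t`. As `|t'|² < t₀²`, this forces `u₀ = 0`, and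
then `u = 0`. -/
theorem minkowski_pos_of_orthogonal {t₀ t₁ t₂ t₃ u₀ u₁ u₂ u₃ : ℝ}
    (ht : -(t₀ * t₀) + t₁ * t₁ + t₂ * t₂ + t₃ * t₃ < 0)
    (hut : -(u₀ * t₀) + u₁ * t₁ + u₂ * t₂ + u₃ * t₃ = 0)
    (hu : ¬ (u₀ = 0 ∧ u₁ = 0 ∧ u₂ = 0 ∧ u₃ = 0)) :
    0 < -(u₀ * u₀) + u₁ * u₁ + u₂ * u₂ + u₃ * u₃ := by
  by_contra! h
  have hcs : (u₀ * t₀) ^ 2 ≤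
      (u₁ * u₁ + u₂ * u₂ + u₃ * u₃) * (t₁ * t₁ + t₂ * t₂ + t₃ * t₃) := by
    rw [show u₀ * t₀ = u₁ * t₁ + u₂ * t₂ + u₃ * t₃ by linarith]
    nlinarith [sq_nonneg (u₁ * t₂ - u₂ * t₁), sq_nonneg (u₁ * t₃ - u₃ * t₁),
      sq_nonneg (u₂ * t₃ - u₃ * t₂)]
  have hle : (u₁ * u₁ + u₂ * u₂ + u₃ * u₃) * (t₁ * t₁ + t₂ * t₂ + t₃ * t₃) ≤
      (u₀ * u₀) * (t₁ * t₁ + t₂ * t₂ + t₃ * t₃) :=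
    mul_le_mul_of_nonneg_right (by linarith)
      (by linarith [mul_self_nonneg t₁, mul_self_nonneg t₂, mul_self_nonneg t₃])
  have h0 : u₀ = 0 := by
    by_contra h0
    have : 0 < u₀ * u₀ := mul_self_pos.mpr h0
    nlinarith
  subst h0
  refine hu ⟨rfl, ?_, ?_, ?_⟩ <;> refine mul_self_eq_zero.mp ?_ <;>
    linarith [mul_self_nonneg u₁, mul_self_nonneg u₂, mul_self_nonneg u₃]

namespace LorentzMetric

variable {M : Type*} [TopologicalSpace M] [ChartedSpace R4 M] [IsManifold (𝓡 4) ∞ M]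
  (g : LorentzMetric M)

/-- A nonzero vector orthogonal to a timelike vector is spacelike. -/
theorem inner_pos_of_orthogonal {x : M} {t u : TangentSpace (𝓡 4) x} (ht : g.inner x t t < 0)
    (hut : g.inner x u t = 0) (hu : u ≠ 0) : 0 < g.inner x u u := by
  obtain ⟨b, hb⟩ := g.signature x
  have key : ∀ u w : TangentSpace (𝓡 4) x, g.inner x u w =
      - (b.repr u 0 * b.repr w 0) + b.repr u 1 * b.repr w 1 + b.repr u 2 * b.repr w 2
        + b.repr u 3 * b.repr w 3 := by
    intro u w
    conv_lhs => rw [← b.sum_repr u, ← b.sum_repr w]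
    simp only [Fin.sum_univ_four, map_add, map_smul, add_apply, smul_apply, hb, smul_eq_mul]
    simp [Fin.ext_iff]
    ring
  have hu' : ∃ i, b.repr u i ≠ 0 := by
    by_contra! h
    exact hu (by rw [← b.sum_repr u]; simp [h])
  rw [key] at ht hut ⊢
  refine minkowski_pos_of_orthogonal ht hut ?_
  rintro ⟨h0, h1, h2, h3⟩
  obtain ⟨i, hi⟩ := hu'
  fin_cases i <;> contradiction

end LorentzMetric

end

noncomputable section

/-! ### Linearity in the direction, and orthonormal bases of the leaves. -/

namespace LorentzMetric

variable {M : Type*} [TopologicalSpace M] [ChartedSpace R4 M] [IsManifold (𝓡 4) ∞ M]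
  (g : LorentzMetric M) {E : Type*} [NormedAddCommGroup E] [NormedSpace ℝ E] {K : Type*}
  [TopologicalSpace K] {I : ModelWithCorners ℝ E K} {H : Type*} [TopologicalSpace H]
  [ChartedSpace K H] {ι : H → M} {Y : (q : H) → TangentSpace (𝓡 4) (ι q)} {q : H}

variable (I ι Y q) in
theorem exists_covAlong_eq : ∃ T : E →L[ℝ] R4, ∀ X : TangentSpace I q,
    g.covAlong I ι Y q X = T X := by
  let dY : E →L[ℝ] R4 := mfderiv I 𝓘(ℝ, R4) (fun q' ↦
    (trivializationAt R4 (TangentSpace (𝓡 4) : M → Type _) (ι q)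
      (⟨ι q', Y q'⟩ : TangentBundle (𝓡 4) M)).2) q
  let dι : E →L[ℝ] R4 := mfderiv I (𝓡 4) ι q
  refine ⟨dY + (g.symbol (ι q) (extChartAt (𝓡 4) (ι q) (ι q))).flip (Y q) ∘L dι, fun X ↦ ?_⟩
  exact congrArg (fun w : R4 ↦ dY X + w) (g.symbol_apply _ _ _ _).symm

theorem covAlong_add_right (X X' : TangentSpace I q) :
    g.covAlong I ι Y q (X + X') = g.covAlong I ι Y q X + g.covAlong I ι Y q X' := by
  obtain ⟨T, hT⟩ := g.exists_covAlong_eq I ι Y q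
  rw [hT, hT, hT]
  exact map_add T X X'

theorem covAlong_smul_right (c : ℝ) (X : TangentSpace I q) :
    g.covAlong I ι Y q (c • X) = c • g.covAlong I ι Y q X := by
  obtain ⟨T, hT⟩ := g.exists_covAlong_eq I ι Y q
  rw [hT, hT]
  exact map_smul T c X

end LorentzMetric

namespace NullFoliation

variable {M : Type*} [TopologicalSpace M] [ChartedSpace R4 M] [IsManifold (𝓡 4) ∞ M]
  {g : LorentzMetric M}
  {K : Type*} [TopologicalSpace K] {I : ModelWithCorners ℝ (EuclideanSpace ℝ (Fin 3)) K}
  {H : Type*} [TopologicalSpace H] [ChartedSpace K H] [IsManifold I ∞ H]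
  (F : NullFoliation g I H)

theorem push_add (q : H) (X X' : TangentSpace I q) :
    F.push q (X + X') = F.push q X + F.push q X' := map_add _ _ _

theorem push_smul (q : H) (c : ℝ) (X : TangentSpace I q) :
    F.push q (c • X) = c • F.push q X := map_smul _ _ _

theorem D_add_right (Y : (q : H) → TangentSpace (𝓡 4) (F.ι q)) (q : H) (X X' : TangentSpace I q) :
    F.D Y q (X + X') = F.D Y q X + F.D Y q X' := g.covAlong_add_right X X'

theorem D_smul_right (Y : (q : H) → TangentSpace (𝓡 4) (F.ι q)) (q : H) (c : ℝ)
    (X : TangentSpace I q) : F.D Y q (c • X) = c • F.D Y q X := g.covAlong_smul_right c X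

/-- The metric on `TH` as a bilinear form. -/
def slashBilin (q : H) : TangentSpace I q →ₗ[ℝ] TangentSpace I q →ₗ[ℝ] ℝ :=
  LinearMap.mk₂ ℝ (F.slash q)
    (fun X X' Y ↦ by simp [slash, push_add]) (fun c X Y ↦ by simp [slash, push_smul])
    (fun X Y Y' ↦ by simp [slash, push_add]) (fun c X Y ↦ by simp [slash, push_smul])

/-- The form `χ̲` as a bilinear form. -/
def chibarBilin (q : H) : TangentSpace I q →ₗ[ℝ] TangentSpace I q →ₗ[ℝ] ℝ :=
  LinearMap.mk₂ ℝ (F.chibar q)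
    (fun X X' Y ↦ by simp [chibar, D_add_right]) (fun c X Y ↦ by simp [chibar, D_smul_right])
    (fun X Y Y' ↦ by simp [chibar, push_add]) (fun c X Y ↦ by simp [chibar, push_smul])

/-- The form `ζ` as a linear form. -/
def zetaLin (q : H) : TangentSpace I q →ₗ[ℝ] ℝ where
  toFun := F.zeta q
  map_add' X X' := by simp [zeta, D_add_right, mul_add]
  map_smul' c X := by simp [zeta, D_smul_right]; ring

theorem slash_symm (q : H) (X Y : TangentSpace I q) : F.slash q X Y = F.slash q Y X :=
  g.symm _ _ _

variable {F}

theorem IsFrame.isNullFrame {q : H} {e : Fin 2 → TangentSpace I q} (he : F.IsFrame q e) :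
    IsNullFrame (F := R4) (g.inner (F.ι q)) (fun A ↦ F.push q (e A)) (F.push q (F.L q))
      (F.Lbar q) where
  symm := g.symm _
  nondegenerate := g.nondegenerate _
  e_e := he.2
  e_l A := (g.symm _ _ _).trans (F.L_orthogonal q (e A))
  e_m A := (g.symm _ _ _).trans (F.Lbar_orthogonal q (e A) (he.1 A))
  l_l := F.L_orthogonal q _
  m_m := F.Lbar_null q
  l_m := F.inner_L_Lbar q

theorem IsFrame.expansion {q : H} {e : Fin 2 → TangentSpace I q} (he : F.IsFrame q e)
    {X : TangentSpace I q} (hX : dirDeriv I F.v q X = 0) :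
    X = ∑ B, F.slash q X (e B) • e B := by
  apply F.immersion_ι q
  have h2 : g.inner (F.ι q) (F.push q X) (F.Lbar q) = 0 :=
    (g.symm _ _ _).trans (F.Lbar_orthogonal q X hX)
  have h3 : g.inner (F.ι q) (F.push q X) (F.push q (F.L q)) = 0 :=
    (g.symm _ _ _).trans (F.L_orthogonal q X)
  have h1 := he.isNullFrame.expansion_of_orthogonal (by simp) h3 h2
  rw [map_sum]
  simp only [map_smul]
  exact h1

variable (F)

/-- The vector `L + Lbar` is timelike, with square `-4`, and orthogonal to the leaf; hence the
induced metric of the leaf is positive definite. Consequently the choice `F.e` really is an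
orthonormal basis. -/
theorem exists_isFrame (q : H) : ∃ e, F.IsFrame q e := by
  let dv : EuclideanSpace ℝ (Fin 3) →L[ℝ] ℝ := mfderiv I 𝓘(ℝ, ℝ) F.v q
  refine exists_orthonormal_of_posDef (E := EuclideanSpace ℝ (Fin 3)) (by simp) (F.slashBilin q)
    (dv : EuclideanSpace ℝ (Fin 3) →ₗ[ℝ] ℝ) ?_ (F.slash_symm q) ?_
  · intro h
    have h1 : dv (F.L q) = 0 := congrArg (fun l : EuclideanSpace ℝ (Fin 3) →ₗ[ℝ] ℝ ↦ l (F.L q)) h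
    exact (F.lapse_pos q).ne' h1
  · intro X hX hX0
    have h0 : F.push q X ≠ 0 := fun h ↦ hX0 (F.immersion_ι q (h.trans (map_zero _).symm))
    refine g.inner_pos_of_orthogonal (t := F.push q (F.L q) + F.Lbar q) ?_ ?_ h0
    · have h1 : g.inner (F.ι q) (F.push q (F.L q)) (F.push q (F.L q)) = 0 := F.L_orthogonal q _
      have h2 : g.inner (F.ι q) (F.push q (F.L q)) (F.Lbar q) = -2 := F.inner_L_Lbar q
      simp only [map_add, add_apply, h1, h2, F.Lbar_null, g.symm (F.ι q) (F.Lbar q)]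
      norm_num
    · rw [map_add, g.symm _ _ (F.push q (F.L q)), g.symm _ _ (F.Lbar q)]
      have h1 : g.inner (F.ι q) (F.push q (F.L q)) (F.push q X) = 0 := F.L_orthogonal q _
      have h2 : g.inner (F.ι q) (F.Lbar q) (F.push q X) = 0 := F.Lbar_orthogonal q X hX
      rw [h1, h2, add_zero]

theorem isFrame_e (q : H) : F.IsFrame q (F.e q) := Classical.epsilon_spec (F.exists_isFrame q)

variable {F}

theorem IsFrame.sum_eq {q : H} {e : Fin 2 → TangentSpace I q} (he : F.IsFrame q e) {V : Type*}
    [AddCommGroup V] [Module ℝ V] (T : TangentSpace I q →ₗ[ℝ] TangentSpace I q →ₗ[ℝ] V) :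
    ∑ A, T (F.e q A) (F.e q A) = ∑ A, T (e A) (e A) :=
  sum_contraction_eq (F.slash_symm q) (fun A ↦ he.expansion ((F.isFrame_e q).1 A))
    (fun A ↦ (F.isFrame_e q).expansion (he.1 A)) T

/-- The bases `F.e q` are chosen point by point, with no continuity in `q`. Recomputing the trace in
a smooth frame is what makes it differentiable. -/
theorem IsFrame.tr_chibar {q : H} {e : Fin 2 → TangentSpace I q} (he : F.IsFrame q e) :
    F.tr F.chibar q = ∑ A, F.chibar q (e A) (e A) := he.sum_eq (F.chibarBilin q)

theorem IsFrame.sharp_eq {q : H} {e : Fin 2 → TangentSpace I q} (he : F.IsFrame q e)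
    {ξ : (q : H) → TangentSpace I q → ℝ} (l : TangentSpace I q →ₗ[ℝ] ℝ) (hl : ∀ X, ξ q X = l X) :
    F.sharp ξ q = ∑ A, ξ q (e A) • e A := by
  simp only [sharp, hl]
  exact he.sum_eq (LinearMap.mk₂ ℝ (fun X Y ↦ l X • Y) (fun _ _ _ ↦ by simp [add_smul])
    (fun _ _ _ ↦ by simp [mul_smul]) (fun _ _ _ ↦ smul_add _ _ _)
    (fun _ _ _ ↦ smul_comm _ _ _))

variable (F)

/-- Pairing with `e_A` already ignores the part normal to the leaf, so the projection in `leafCov`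
can be dropped. -/
theorem div_eq (ξ : (q : H) → TangentSpace I q → ℝ) (q : H) :
    F.div ξ q = ∑ A, g.inner (F.ι q) (F.D (fun q' ↦ F.push q' (F.sharp ξ q')) q (F.e q A))
      (F.push q (F.e q A)) := by
  have h := (F.isFrame_e q).2
  simp only [div, leafCov]
  refine Finset.sum_congr rfl fun A _ ↦ ?_
  change F.slashBilin q _ _ = _
  simp only [Fin.sum_univ_two, map_add, map_smul, LinearMap.add_apply, LinearMap.smul_apply,
    smul_eq_mul]
  change _ * F.slash q _ _ + _ * F.slash q _ _ = _
  rw [h, h]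
  revert A
  exact Fin.forall_fin_two.mpr ⟨by simp, by simp⟩

/-- The leaf has dimension two: the metric has square norm `2`, so the two cross terms and the
product of the pure traces combine to `-½ tr χ tr χ̲`. -/
theorem dot₂_hat (q : H) :
    F.dot₂ (F.hat F.chi) (F.hat F.chibar) q =
      F.dot₂ F.chi F.chibar q - 1 / 2 * F.tr F.chi q * F.tr F.chibar q := by
  have h := (F.isFrame_e q).2
  simp only [dot₂, hat, tr, Fin.sum_univ_two, h]
  simp
  ring

end NullFoliation

end

noncomputable section

/-! ### The null foliation read in fixed charts around `q₀` and `ι q₀`. -/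

namespace NullFoliation

variable {M : Type*} [TopologicalSpace M] [ChartedSpace R4 M] [IsManifold (𝓡 4) ∞ M]
  {g : LorentzMetric M}
  {K : Type*} [TopologicalSpace K] {I : ModelWithCorners ℝ (EuclideanSpace ℝ (Fin 3)) K}
  {H : Type*} [TopologicalSpace H] [ChartedSpace K H] [IsManifold I ∞ H]
  (F : NullFoliation g I H) (q₀ : H)

/-- The part of the preferred chart around `q₀` that is mapped to the preferred chart around
`ι q₀`. -/
def coordDomain : Set (EuclideanSpace ℝ (Fin 3)) :=
  (extChartAt I q₀).target ∩
    (extChartAt I q₀).symm ⁻¹' (F.ι ⁻¹' (extChartAt (𝓡 4) (F.ι q₀)).source)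

/-- The immersion `ι` in the preferred charts around `q₀` and `ι q₀`. -/
def coordMap (y : EuclideanSpace ℝ (Fin 3)) : R4 :=
  extChartAt (𝓡 4) (F.ι q₀) (F.ι ((extChartAt I q₀).symm y))

/-- The generator `L` in the preferred chart around `q₀`. -/
def coordL (y : EuclideanSpace ℝ (Fin 3)) : EuclideanSpace ℝ (Fin 3) :=
  tangentCoordChange I ((extChartAt I q₀).symm y) q₀ ((extChartAt I q₀).symm y)
    (F.L ((extChartAt I q₀).symm y))

/-- The null normal `Lbar` in the preferred charts around `q₀` and `ι q₀`. -/
def coordLbar (y : EuclideanSpace ℝ (Fin 3)) : R4 :=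
  tangentCoordChange (𝓡 4) (F.ι ((extChartAt I q₀).symm y)) (F.ι q₀)
    (F.ι ((extChartAt I q₀).symm y)) (F.Lbar ((extChartAt I q₀).symm y))

/-- The function `v` in the preferred chart around `q₀`. -/
def coordV (y : EuclideanSpace ℝ (Fin 3)) : ℝ := F.v ((extChartAt I q₀).symm y)

theorem isChartDomain_coordDomain : IsChartDomain I q₀ (F.coordDomain q₀) where
  subset_target := Set.inter_subset_left
  mem_nhdsWithin {y} hy := by
    have h1 : ContinuousWithinAt (F.ι ∘ (extChartAt I q₀).symm) (Set.range I) y :=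
      F.contMDiff_ι.continuous.continuousAt.comp_continuousWithinAt
        (mdifferentiableWithinAt_extChartAt_symm hy.1).continuousWithinAt
    exact Filter.inter_mem (extChartAt_target_mem_nhdsWithin_of_mem hy.1)
      (h1 (extChartAt_source_mem_nhds' hy.2))

theorem mem_coordDomain : extChartAt I q₀ q₀ ∈ F.coordDomain q₀ := by
  refine ⟨mem_extChartAt_target q₀, ?_⟩
  simp only [Set.mem_preimage, extChartAt_to_inv]
  exact mem_extChartAt_source _

theorem contMDiffOn_symm_coordDomain :
    ContMDiffOn 𝓘(ℝ, EuclideanSpace ℝ (Fin 3)) I ∞ (extChartAt I q₀).symm (F.coordDomain q₀) :=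
  (contMDiffOn_extChartAt_symm q₀).mono Set.inter_subset_left

theorem contDiffOn_coordMap : ContDiffOn ℝ ∞ (F.coordMap q₀) (F.coordDomain q₀) := by
  rw [← contMDiffOn_iff_contDiffOn]
  refine (contMDiffOn_extChartAt (I := 𝓡 4) (x := F.ι q₀)).comp
    (F.contMDiff_ι.comp_contMDiffOn (F.contMDiffOn_symm_coordDomain q₀)) fun y hy ↦ ?_
  rw [← extChartAt_source (𝓡 4)]
  exact hy.2

theorem contDiffOn_coordL : ContDiffOn ℝ ∞ (F.coordL q₀) (F.coordDomain q₀) := by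
  rw [← contMDiffOn_iff_contDiffOn]
  have h1 := (trivializationAt (EuclideanSpace ℝ (Fin 3)) (TangentSpace I : H → Type _)
    q₀).contMDiffOn (n := ∞) (IB := I)
  have h2 := h1.comp (F.contMDiff_L.comp_contMDiffOn (F.contMDiffOn_symm_coordDomain q₀))
    (fun y hy ↦ by
      change (extChartAt I q₀).symm y ∈ (chartAt K q₀).source
      rw [← extChartAt_source I]
      exact (extChartAt I q₀).map_target hy.1)
  exact contMDiff_snd.comp_contMDiffOn h2

theorem contDiffOn_coordLbar : ContDiffOn ℝ ∞ (F.coordLbar q₀) (F.coordDomain q₀) := by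
  rw [← contMDiffOn_iff_contDiffOn]
  have h1 := (trivializationAt R4 (TangentSpace (𝓡 4) : M → Type _)
    (F.ι q₀)).contMDiffOn (n := ∞) (IB := 𝓡 4)
  have h2 := h1.comp (F.contMDiff_Lbar.comp_contMDiffOn (F.contMDiffOn_symm_coordDomain q₀))
    (fun y hy ↦ by
      change F.ι ((extChartAt I q₀).symm y) ∈ (chartAt R4 (F.ι q₀)).source
      rw [← extChartAt_source (𝓡 4)]
      exact hy.2)
  exact contMDiff_snd.comp_contMDiffOn h2

theorem contDiffOn_coordV : ContDiffOn ℝ ∞ (F.coordV q₀) (F.coordDomain q₀) := by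
  rw [← contMDiffOn_iff_contDiffOn]
  exact F.contMDiff_v.comp_contMDiffOn (F.contMDiffOn_symm_coordDomain q₀)

/-- `U` is a relatively open part of the coordinate domain around `q₀`. -/
structure IsCoordDomain (U : Set (EuclideanSpace ℝ (Fin 3))) : Prop
    extends IsChartDomain I q₀ U where
  subset_coordDomain : U ⊆ F.coordDomain q₀

variable {F q₀} {U : Set (EuclideanSpace ℝ (Fin 3))} {q : H}

namespace IsCoordDomain

theorem exists_eq (hU : F.IsCoordDomain q₀ U) {y : EuclideanSpace ℝ (Fin 3)} (hy : y ∈ U) :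
    ∃ q ∈ (extChartAt I q₀).source, extChartAt I q₀ q = y :=
  ⟨_, (extChartAt I q₀).map_target (hU.subset_target hy),
    (extChartAt I q₀).right_inv (hU.subset_target hy)⟩

theorem mem_source (hU : F.IsCoordDomain q₀ U) (hq : q ∈ (extChartAt I q₀).source)
    (hqU : extChartAt I q₀ q ∈ U) : F.ι q ∈ (extChartAt (𝓡 4) (F.ι q₀)).source := by
  have := (hU.subset_coordDomain hqU).2
  rwa [Set.mem_preimage, (extChartAt I q₀).left_inv hq] at this

theorem coordMap_eq (hq : q ∈ (extChartAt I q₀).source) :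
    F.coordMap q₀ (extChartAt I q₀ q) = extChartAt (𝓡 4) (F.ι q₀) (F.ι q) := by
  rw [coordMap, (extChartAt I q₀).left_inv hq]

theorem coordL_eq (hq : q ∈ (extChartAt I q₀).source) :
    F.coordL q₀ (extChartAt I q₀ q) = tangentCoordChange I q q₀ q (F.L q) := by
  rw [coordL, (extChartAt I q₀).left_inv hq]

theorem coordLbar_eq (hq : q ∈ (extChartAt I q₀).source) :
    F.coordLbar q₀ (extChartAt I q₀ q) =
      tangentCoordChange (𝓡 4) (F.ι q) (F.ι q₀) (F.ι q) (F.Lbar q) := by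
  rw [coordLbar, (extChartAt I q₀).left_inv hq]

theorem eventually_coordMap (hq : q ∈ (extChartAt I q₀).source) :
    ∀ᶠ q' in nhds q,
      extChartAt (𝓡 4) (F.ι q₀) (F.ι q') = F.coordMap q₀ (extChartAt I q₀ q') := by
  filter_upwards [extChartAt_source_mem_nhds' hq] with q' hq'
  exact (coordMap_eq hq').symm

theorem contDiffOn_coordMap (hU : F.IsCoordDomain q₀ U) : ContDiffOn ℝ ∞ (F.coordMap q₀) U :=
  (F.contDiffOn_coordMap q₀).mono hU.subset_coordDomain

theorem push_eq (hU : F.IsCoordDomain q₀ U) (hq : q ∈ (extChartAt I q₀).source)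
    (hqU : extChartAt I q₀ q ∈ U) (X : TangentSpace I q) :
    tangentCoordChange (𝓡 4) (F.ι q) (F.ι q₀) (F.ι q) (F.push q X) =
      fderivWithin ℝ (F.coordMap q₀) U (extChartAt I q₀ q) (tangentCoordChange I q q₀ q X) :=
  LorentzMetric.tangentCoordChange_mfderiv hU.toIsChartDomain hq hqU
    (F.contMDiff_ι.mdifferentiableAt (by simp)) (hU.mem_source hq hqU)
    (hU.contDiffOn_coordMap.differentiableOn (by simp) _ hqU) (eventually_coordMap hq) X

theorem D_eq (hU : F.IsCoordDomain q₀ U) (hq : q ∈ (extChartAt I q₀).source)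
    (hqU : extChartAt I q₀ q ∈ U) {Y : (q : H) → TangentSpace (𝓡 4) (F.ι q)}
    {Y' : EuclideanSpace ℝ (Fin 3) → R4} (hY' : ContDiffOn ℝ ∞ Y' U)
    (hY : ∀ q ∈ (extChartAt I q₀).source, extChartAt I q₀ q ∈ U →
      tangentCoordChange (𝓡 4) (F.ι q) (F.ι q₀) (F.ι q) (Y q) = Y' (extChartAt I q₀ q))
    (X : TangentSpace I q) :
    tangentCoordChange (𝓡 4) (F.ι q) (F.ι q₀) (F.ι q) (F.D Y q X) =
      localCov (g.symbol (F.ι q₀)) (F.coordMap q₀) U Y' (extChartAt I q₀ q)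
        (tangentCoordChange I q q₀ q X) :=
  g.tangentCoordChange_covAlong hU.toIsChartDomain hq hqU
    (F.contMDiff_ι.mdifferentiableAt (by simp)) (hU.mem_source hq hqU)
    (hU.contDiffOn_coordMap.differentiableOn (by simp) _ hqU) (eventually_coordMap hq)
    (hY'.differentiableOn (by simp) _ hqU)
    ((hU.toIsChartDomain.eventually hq hqU).mono fun q' h ↦ hY q' h.1 h.2) X

theorem inner_eq (hU : F.IsCoordDomain q₀ U) (hq : q ∈ (extChartAt I q₀).source)
    (hqU : extChartAt I q₀ q ∈ U) (u w : TangentSpace (𝓡 4) (F.ι q)) {u' w' : R4}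
    (hu : tangentCoordChange (𝓡 4) (F.ι q) (F.ι q₀) (F.ι q) u = u')
    (hw : tangentCoordChange (𝓡 4) (F.ι q) (F.ι q₀) (F.ι q) w = w') :
    g.inner (F.ι q) u w = g.inChart (F.ι q₀) (F.coordMap q₀ (extChartAt I q₀ q)) u' w' := by
  rw [coordMap_eq hq, ← hu, ← hw]
  exact (g.inChart_tangentCoordChange (F.ι q₀) (hU.mem_source hq hqU) u w).symm

theorem dirDeriv_eq (hU : F.IsCoordDomain q₀ U) (hq : q ∈ (extChartAt I q₀).source)
    (hqU : extChartAt I q₀ q ∈ U) {h : H → ℝ} {h' : EuclideanSpace ℝ (Fin 3) → ℝ}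
    (hh' : ContDiffOn ℝ ∞ h' U)
    (hh : ∀ q ∈ (extChartAt I q₀).source, extChartAt I q₀ q ∈ U → h q = h' (extChartAt I q₀ q)) :
    MDifferentiableAt I 𝓘(ℝ, ℝ) h q ∧ ∀ X : TangentSpace I q, dirDeriv I h q X =
      fderivWithin ℝ h' U (extChartAt I q₀ q) (tangentCoordChange I q q₀ q X) := by
  have h1 := hU.toIsChartDomain.hasMFDerivAt hq hqU (hh'.differentiableOn (by simp) _ hqU)
    ((hU.toIsChartDomain.eventually hq hqU).mono fun q' h ↦ hh q' h.1 h.2)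
  refine ⟨h1.mdifferentiableAt, fun X ↦ ?_⟩
  rw [dirDeriv, h1.mfderiv]
  rfl

theorem tangentCoordChange_symm (hq : q ∈ (extChartAt I q₀).source)
    (X : EuclideanSpace ℝ (Fin 3)) :
    tangentCoordChange I q q₀ q (tangentCoordChange I q₀ q q X) = X := by
  have hqq := mem_extChartAt_source (I := I) q
  rw [tangentCoordChange_comp ⟨⟨hq, hqq⟩, hq⟩, tangentCoordChange_self hq]

theorem dirDeriv_v (hU : F.IsCoordDomain q₀ U) (hq : q ∈ (extChartAt I q₀).source)
    (hqU : extChartAt I q₀ q ∈ U) (X : TangentSpace I q) :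
    dirDeriv I F.v q X = fderivWithin ℝ (F.coordV q₀) U (extChartAt I q₀ q)
      (tangentCoordChange I q q₀ q X) :=
  (hU.dirDeriv_eq hq hqU ((F.contDiffOn_coordV q₀).mono hU.subset_coordDomain) (fun q hq _ ↦ by
    rw [coordV, (extChartAt I q₀).left_inv hq])).2 X

theorem push_L (hU : F.IsCoordDomain q₀ U) (hq : q ∈ (extChartAt I q₀).source)
    (hqU : extChartAt I q₀ q ∈ U) :
    tangentCoordChange (𝓡 4) (F.ι q) (F.ι q₀) (F.ι q) (F.push q (F.L q)) =
      fderivWithin ℝ (F.coordMap q₀) U (extChartAt I q₀ q) (F.coordL q₀ (extChartAt I q₀ q)) := by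
  rw [coordL_eq hq]
  exact hU.push_eq hq hqU (F.L q)

theorem contDiffOn_push (hU : F.IsCoordDomain q₀ U)
    {X : EuclideanSpace ℝ (Fin 3) → EuclideanSpace ℝ (Fin 3)} (hX : ContDiffOn ℝ ∞ X U) :
    ContDiffOn ℝ ∞ (fun y ↦ fderivWithin ℝ (F.coordMap q₀) U y (X y)) U :=
  (hU.contDiffOn_coordMap.fderivWithin hU.toIsChartDomain.uniqueDiffOn (by simp)).clm_apply hX

theorem contDiffOn_coordL (hU : F.IsCoordDomain q₀ U) : ContDiffOn ℝ ∞ (F.coordL q₀) U :=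
  (F.contDiffOn_coordL q₀).mono hU.subset_coordDomain

theorem contDiffOn_coordLbar (hU : F.IsCoordDomain q₀ U) : ContDiffOn ℝ ∞ (F.coordLbar q₀) U :=
  (F.contDiffOn_coordLbar q₀).mono hU.subset_coordDomain

theorem D_L (hU : F.IsCoordDomain q₀ U) (hq : q ∈ (extChartAt I q₀).source)
    (hqU : extChartAt I q₀ q ∈ U) (X : TangentSpace I q) :
    tangentCoordChange (𝓡 4) (F.ι q) (F.ι q₀) (F.ι q)
        (F.D (fun q' ↦ F.push q' (F.L q')) q X) =
      localCov (g.symbol (F.ι q₀)) (F.coordMap q₀) U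
        (fun y ↦ fderivWithin ℝ (F.coordMap q₀) U y (F.coordL q₀ y)) (extChartAt I q₀ q)
        (tangentCoordChange I q q₀ q X) :=
  hU.D_eq hq hqU (hU.contDiffOn_push hU.contDiffOn_coordL) (fun _ ↦ hU.push_L) X

theorem D_Lbar (hU : F.IsCoordDomain q₀ U) (hq : q ∈ (extChartAt I q₀).source)
    (hqU : extChartAt I q₀ q ∈ U) (X : TangentSpace I q) :
    tangentCoordChange (𝓡 4) (F.ι q) (F.ι q₀) (F.ι q) (F.D F.Lbar q X) =
      localCov (g.symbol (F.ι q₀)) (F.coordMap q₀) U (F.coordLbar q₀) (extChartAt I q₀ q)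
        (tangentCoordChange I q q₀ q X) :=
  hU.D_eq hq hqU hU.contDiffOn_coordLbar (fun _ hq _ ↦ (coordLbar_eq hq).symm) X

theorem slash_eq (hU : F.IsCoordDomain q₀ U) (hq : q ∈ (extChartAt I q₀).source)
    (hqU : extChartAt I q₀ q ∈ U) (X Y : TangentSpace I q) :
    F.slash q X Y = g.inChart (F.ι q₀) (F.coordMap q₀ (extChartAt I q₀ q))
      (fderivWithin ℝ (F.coordMap q₀) U (extChartAt I q₀ q) (tangentCoordChange I q q₀ q X))
      (fderivWithin ℝ (F.coordMap q₀) U (extChartAt I q₀ q) (tangentCoordChange I q q₀ q Y)) :=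
  hU.inner_eq hq hqU _ _ (hU.push_eq hq hqU X) (hU.push_eq hq hqU Y)

end IsCoordDomain

end NullFoliation

end

noncomputable section

/-! ### Existence of a smooth local null frame. -/

namespace NullFoliation

variable {M : Type*} [TopologicalSpace M] [ChartedSpace R4 M] [IsManifold (𝓡 4) ∞ M]
  {g : LorentzMetric M}
  {K : Type*} [TopologicalSpace K] {I : ModelWithCorners ℝ (EuclideanSpace ℝ (Fin 3)) K}
  {H : Type*} [TopologicalSpace H] [ChartedSpace K H] [IsManifold I ∞ H]
  {F : NullFoliation g I H} {q₀ : H} {U : Set (EuclideanSpace ℝ (Fin 3))}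

namespace IsCoordDomain

theorem localNullFoliation (hU : F.IsCoordDomain q₀ U)
    {e : Fin 2 → EuclideanSpace ℝ (Fin 3) → EuclideanSpace ℝ (Fin 3)}
    (he : ∀ A, ContDiffOn ℝ ∞ (e A) U)
    (hve : ∀ y ∈ U, ∀ A, fderivWithin ℝ (F.coordV q₀) U y (e A y) = 0)
    (hee : ∀ y ∈ U, ∀ A B, g.inChart (F.ι q₀) (F.coordMap q₀ y)
      (fderivWithin ℝ (F.coordMap q₀) U y (e A y)) (fderivWithin ℝ (F.coordMap q₀) U y (e B y)) =
        if A = B then 1 else 0) :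
    LocalNullFoliation (g.inChart (F.ι q₀)) (g.symbol (F.ι q₀)) (extChartAt (𝓡 4) (F.ι q₀)).target
      U (F.coordMap q₀) (F.coordL q₀) (F.coordLbar q₀) (F.coordV q₀) e where
  leviCivita := g.isLeviCivitaOn (F.ι q₀)
  uniqueDiffOn := hU.toIsChartDomain.uniqueDiffOn
  subset_closure_interior := hU.toIsChartDomain.subset_closure_interior
  mapsTo y hy := (extChartAt (𝓡 4) (F.ι q₀)).map_source (hU.subset_coordDomain hy).2
  contDiffOn_f := hU.contDiffOn_coordMap
  contDiffOn_L := hU.contDiffOn_coordL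
  contDiffOn_m := hU.contDiffOn_coordLbar
  contDiffOn_v := (F.contDiffOn_coordV q₀).mono hU.subset_coordDomain
  contDiffOn_e := he
  injective {y} hy := by
    obtain ⟨q, hq, rfl⟩ := hU.exists_eq hy
    rw [injective_iff_map_eq_zero]
    intro X hX
    have hqq := mem_extChartAt_source (I := I) q
    have hpp := mem_extChartAt_source (I := 𝓡 4) (F.ι q)
    have hp := hU.mem_source hq hy
    let X' : TangentSpace I q := tangentCoordChange I q₀ q q X
    have h1 := hU.push_eq hq hy X'
    rw [tangentCoordChange_symm hq X, hX] at h1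
    -- The change of chart on `M` is invertible at `ι q`, so injectivity may be tested on the
    -- intrinsic derivative.
    have h2 : F.push q X' = 0 := by
      have h3 := tangentCoordChange_comp (I := 𝓡 4) (w := F.ι q) (x := F.ι q₀) (y := F.ι q)
        (z := F.ι q) (v := (F.push q X' : R4)) ⟨⟨hpp, hp⟩, hpp⟩
      rw [h1, map_zero] at h3
      exact (h3.trans (tangentCoordChange_self hpp)).symm
    have h4 : X' = 0 := F.immersion_ι q (h2.trans (map_zero _).symm)
    rw [← tangentCoordChange_symm hq X]
    exact (congrArg (tangentCoordChange I q q₀ q) h4).trans (map_zero _)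
  L_orthogonal {y} hy X := by
    obtain ⟨q, hq, rfl⟩ := hU.exists_eq hy
    have h1 := hU.push_eq hq hy (tangentCoordChange I q₀ q q X)
    rw [tangentCoordChange_symm hq X] at h1
    exact (hU.inner_eq hq hy _ _ (hU.push_L hq hy) h1).symm.trans (F.L_orthogonal q _)
  geodesic {y} hy := by
    obtain ⟨q, hq, rfl⟩ := hU.exists_eq hy
    have h1 := hU.D_L hq hy (F.L q)
    rw [← coordL_eq hq] at h1
    rw [← h1]
    exact (congrArg (tangentCoordChange (𝓡 4) (F.ι q) (F.ι q₀) (F.ι q))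
      (F.L_geodesic q)).trans (map_zero _)
  m_m {y} hy := by
    obtain ⟨q, hq, rfl⟩ := hU.exists_eq hy
    exact (hU.inner_eq hq hy _ _ (coordLbar_eq hq).symm (coordLbar_eq hq).symm).symm.trans
      (F.Lbar_null q)
  L_m {y} hy := by
    obtain ⟨q, hq, rfl⟩ := hU.exists_eq hy
    exact (hU.inner_eq hq hy _ _ (hU.push_L hq hy) (coordLbar_eq hq).symm).symm.trans
      (F.inner_L_Lbar q)
  e_m {y} hy A := by
    obtain ⟨q, hq, rfl⟩ := hU.exists_eq hy
    let X : TangentSpace I q := tangentCoordChange I q₀ q q (e A (extChartAt I q₀ q))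
    have h1 := hU.push_eq hq hy X
    have h2 := hU.dirDeriv_v hq hy X
    rw [tangentCoordChange_symm hq] at h1 h2
    rw [hve _ hy] at h2
    refine (hU.inner_eq hq hy _ _ h1 (coordLbar_eq hq).symm).symm.trans ?_
    exact (g.symm _ _ _).trans (F.Lbar_orthogonal q X h2)
  e_e {y} hy := hee y hy
  v_e {y} hy := hve y hy
  lapse_pos {y} hy := by
    obtain ⟨q, hq, rfl⟩ := hU.exists_eq hy
    rw [coordL_eq hq, ← hU.dirDeriv_v hq hy]
    exact F.lapse_pos q

end IsCoordDomain

variable (F q₀) in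
/-- The orthonormal basis `F.e q₀` extends to a smooth local orthonormal frame of the leaves. -/
theorem exists_localNullFoliation :
    ∃ (U : Set (EuclideanSpace ℝ (Fin 3)))
      (e : Fin 2 → EuclideanSpace ℝ (Fin 3) → EuclideanSpace ℝ (Fin 3)),
      F.IsCoordDomain q₀ U ∧ extChartAt I q₀ q₀ ∈ U ∧
      LocalNullFoliation (g.inChart (F.ι q₀)) (g.symbol (F.ι q₀))
        (extChartAt (𝓡 4) (F.ι q₀)).target U (F.coordMap q₀) (F.coordL q₀) (F.coordLbar q₀)
        (F.coordV q₀) e ∧ ∀ A, e A (extChartAt I q₀ q₀) = F.e q₀ A := by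
  set W := F.coordDomain q₀
  have hW : F.IsCoordDomain q₀ W := ⟨F.isChartDomain_coordDomain q₀, subset_rfl⟩
  have hu := hW.toIsChartDomain.uniqueDiffOn
  have hq₀ := mem_extChartAt_source (I := I) q₀
  have hq₀W : extChartAt I q₀ q₀ ∈ W := F.mem_coordDomain q₀
  have hdf : ContDiffOn ℝ ∞ (fderivWithin ℝ (F.coordMap q₀) W) W :=
    hW.contDiffOn_coordMap.fderivWithin hu (by simp)
  have hG : ContDiffOn ℝ ∞ (fun y ↦ g.inChart (F.ι q₀) (F.coordMap q₀ y)) W :=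
    (g.contDiffOn_inChart (F.ι q₀)).comp hW.contDiffOn_coordMap
      fun y hy ↦ (extChartAt (𝓡 4) (F.ι q₀)).map_source hy.2
  have hvL : ∀ y ∈ W, fderivWithin ℝ (F.coordV q₀) W y (F.coordL q₀ y) ≠ 0 := by
    intro y hy
    obtain ⟨q, hq, rfl⟩ := hW.exists_eq hy
    rw [IsCoordDomain.coordL_eq hq, ← hW.dirDeriv_v hq hy]
    exact (F.lapse_pos q).ne'
  let a : Fin 2 → EuclideanSpace ℝ (Fin 3) := fun A ↦ tangentCoordChange I q₀ q₀ q₀ (F.e q₀ A)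
  have hva : ∀ A, fderivWithin ℝ (F.coordV q₀) W (extChartAt I q₀ q₀) (a A) = 0 := fun A ↦
    (hW.dirDeriv_v hq₀ hq₀W (F.e q₀ A)).symm.trans ((F.isFrame_e q₀).1 A)
  have haa : ∀ A A', g.inChart (F.ι q₀) (F.coordMap q₀ (extChartAt I q₀ q₀))
      (fderivWithin ℝ (F.coordMap q₀) W (extChartAt I q₀ q₀) (a A))
      (fderivWithin ℝ (F.coordMap q₀) W (extChartAt I q₀ q₀) (a A')) =
        if A = A' then 1 else 0 := fun A A' ↦
    (hW.slash_eq hq₀ hq₀W (F.e q₀ A) (F.e q₀ A')).symm.trans ((F.isFrame_e q₀).2 A A')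
  obtain ⟨V, e, hV, hq₀V, he, hea, hVe⟩ := exists_orthonormal_frame hq₀W (hG.bilinearComp hdf)
    ((F.contDiffOn_coordV q₀).fderivWithin hu (by simp)) (F.contDiffOn_coordL q₀)
    (fun y _ u w ↦ g.inChart_symm (F.ι q₀) (F.coordMap q₀ y)
      (fderivWithin ℝ (F.coordMap q₀) W y u) (fderivWithin ℝ (F.coordMap q₀) W y w)) hvL a hva haa
  have hU : F.IsCoordDomain q₀ (W ∩ V) :=
    { subset_target := Set.inter_subset_left.trans hW.subset_target
      mem_nhdsWithin := fun hy ↦ Filter.inter_mem (hW.mem_nhdsWithin hy.1)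
        (mem_nhdsWithin_of_mem_nhds (hV.mem_nhds hy.2))
      subset_coordDomain := Set.inter_subset_left }
  refine ⟨W ∩ V, e, hU, ⟨hq₀W, hq₀V⟩, hU.localNullFoliation he ?_ ?_,
    fun A ↦ (hea A).trans (tangentCoordChange_self hq₀)⟩
  · intro y hy A
    -- Intersecting with the open set `V` does not change derivatives within the set, so the frame
    -- built over `W` serves over `W ∩ V`.
    rw [fderivWithin_inter (hV.mem_nhds hy.2)]
    exact (hVe y hy).1 A
  · intro y hy A A'
    rw [fderivWithin_inter (hV.mem_nhds hy.2)]
    exact (hVe y hy).2 A A'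

end NullFoliation

end

noncomputable section

/-! ### The vacuum equations in a null frame, and coordinate formulas for the null components. -/

namespace LorentzMetric

variable {M : Type*} [TopologicalSpace M] [ChartedSpace R4 M] [IsManifold (𝓡 4) ∞ M]
  {g : LorentzMetric M}

/-- The contraction of the Einstein vacuum equations with a null frame. -/
theorem IsVacuum.sum_riemann (hg : g.IsVacuum) (x : M) {e : Fin 2 → R4} {l m : R4}
    (h : IsNullFrame (g.inChart x (extChartAt (𝓡 4) x x)) e l m) :
    ∑ A, g.inChart x (extChartAt (𝓡 4) x x)
        (localRiemann (g.symbol x) (extChartAt (𝓡 4) x x) l (e A) m) (e A) =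
      1 / 2 * g.inChart x (extChartAt (𝓡 4) x x) m
        (localRiemann (g.symbol x) (extChartAt (𝓡 4) x x) m l l) := by
  set z := extChartAt (𝓡 4) x x
  let T : R4 →ₗ[ℝ] R4 :=
    { toFun := fun u ↦ localRiemann (g.symbol x) z u l m
      map_add' := fun u w ↦ by simp only [localRiemann, map_add, add_apply]; abel
      map_smul' := fun c u ↦ by
        simp only [localRiemann, map_smul, smul_apply, RingHom.id_apply]; module }
  -- Expand the trace of `u ↦ R(u, l) m` in the null frame. The `l` entry vanishes since `R(l, l) =
  -- 0`, and skew-adjointness turns the `m` entry into the component that defines `ρ`.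
  have h0 := hg x l m
  rw [g.ricci_eq_trace x l m T (fun u ↦ (g.riemann_eq x u l m).symm),
    h.trace_eq (by simp) T] at h0
  have hT : ∀ u, T u = localRiemann (g.symbol x) z u l m := fun _ ↦ rfl
  have hanti : ∀ u w t, localRiemann (g.symbol x) z u w t = - localRiemann (g.symbol x) z w u t := by
    intro u w t
    simp only [localRiemann]
    abel
  have hll : localRiemann (g.symbol x) z l l m = 0 := by
    simp [localRiemann]
  have hskew := (g.isLeviCivitaOn x).metric_localRiemann_skew (mem_extChartAt_target x) m l m l
  simp only [hT, hll, map_zero, zero_apply, mul_zero, sub_zero] at h0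
  rw [hskew, h.symm (localRiemann (g.symbol x) z m l l) m] at h0
  simp only [hanti (e _) l, map_neg, neg_apply, Finset.sum_neg_distrib] at h0
  linarith

end LorentzMetric

namespace NullFoliation

variable {M : Type*} [TopologicalSpace M] [ChartedSpace R4 M] [IsManifold (𝓡 4) ∞ M]
  {g : LorentzMetric M}
  {K : Type*} [TopologicalSpace K] {I : ModelWithCorners ℝ (EuclideanSpace ℝ (Fin 3)) K}
  {H : Type*} [TopologicalSpace H] [ChartedSpace K H] [IsManifold I ∞ H]
  {F : NullFoliation g I H} {q₀ q : H} {U : Set (EuclideanSpace ℝ (Fin 3))}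
  {e : Fin 2 → EuclideanSpace ℝ (Fin 3) → EuclideanSpace ℝ (Fin 3)}

namespace IsCoordDomain

theorem chi_eq (hU : F.IsCoordDomain q₀ U) (hq : q ∈ (extChartAt I q₀).source)
    (hqU : extChartAt I q₀ q ∈ U) (X Y : TangentSpace I q) :
    F.chi q X Y = g.inChart (F.ι q₀) (F.coordMap q₀ (extChartAt I q₀ q))
      (localCov (g.symbol (F.ι q₀)) (F.coordMap q₀) U
        (fun y ↦ fderivWithin ℝ (F.coordMap q₀) U y (F.coordL q₀ y)) (extChartAt I q₀ q)
        (tangentCoordChange I q q₀ q X))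
      (fderivWithin ℝ (F.coordMap q₀) U (extChartAt I q₀ q) (tangentCoordChange I q q₀ q Y)) :=
  hU.inner_eq hq hqU _ _ (hU.D_L hq hqU X) (hU.push_eq hq hqU Y)

theorem chibar_eq (hU : F.IsCoordDomain q₀ U) (hq : q ∈ (extChartAt I q₀).source)
    (hqU : extChartAt I q₀ q ∈ U) (X Y : TangentSpace I q) :
    F.chibar q X Y = g.inChart (F.ι q₀) (F.coordMap q₀ (extChartAt I q₀ q))
      (localCov (g.symbol (F.ι q₀)) (F.coordMap q₀) U (F.coordLbar q₀) (extChartAt I q₀ q)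
        (tangentCoordChange I q q₀ q X))
      (fderivWithin ℝ (F.coordMap q₀) U (extChartAt I q₀ q) (tangentCoordChange I q q₀ q Y)) :=
  hU.inner_eq hq hqU _ _ (hU.D_Lbar hq hqU X) (hU.push_eq hq hqU Y)

theorem zeta_eq (hU : F.IsCoordDomain q₀ U) (hq : q ∈ (extChartAt I q₀).source)
    (hqU : extChartAt I q₀ q ∈ U) (X : TangentSpace I q) :
    F.zeta q X = 1 / 2 * g.inChart (F.ι q₀) (F.coordMap q₀ (extChartAt I q₀ q))
      (localCov (g.symbol (F.ι q₀)) (F.coordMap q₀) U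
        (fun y ↦ fderivWithin ℝ (F.coordMap q₀) U y (F.coordL q₀ y)) (extChartAt I q₀ q)
        (tangentCoordChange I q q₀ q X))
      (F.coordLbar q₀ (extChartAt I q₀ q)) :=
  congrArg (1 / 2 * ·) (hU.inner_eq hq hqU _ _ (hU.D_L hq hqU X) (coordLbar_eq hq).symm)

theorem etabar_eq (hU : F.IsCoordDomain q₀ U) (hq : q ∈ (extChartAt I q₀).source)
    (hqU : extChartAt I q₀ q ∈ U) (X : TangentSpace I q) :
    F.etabar q X = 1 / 2 * g.inChart (F.ι q₀) (F.coordMap q₀ (extChartAt I q₀ q))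
      (localCov (g.symbol (F.ι q₀)) (F.coordMap q₀) U (F.coordLbar q₀) (extChartAt I q₀ q)
        (F.coordL q₀ (extChartAt I q₀ q)))
      (fderivWithin ℝ (F.coordMap q₀) U (extChartAt I q₀ q) (tangentCoordChange I q q₀ q X)) := by
  rw [coordL_eq hq]
  exact congrArg (1 / 2 * ·) (hU.inner_eq hq hqU _ _ (hU.D_Lbar hq hqU (F.L q))
    (hU.push_eq hq hqU X))

theorem lapse_eq (hU : F.IsCoordDomain q₀ U) (hq : q ∈ (extChartAt I q₀).source)
    (hqU : extChartAt I q₀ q ∈ U) :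
    F.lapse q = fderivWithin ℝ (F.coordV q₀) U (extChartAt I q₀ q)
      (F.coordL q₀ (extChartAt I q₀ q)) := by
  rw [coordL_eq hq]
  exact hU.dirDeriv_v hq hqU (F.L q)

/-- A frame in coordinates is an orthonormal basis of the tangent spaces of the leaves. -/
theorem isFrame (hU : F.IsCoordDomain q₀ U)
    (h : LocalNullFoliation (g.inChart (F.ι q₀)) (g.symbol (F.ι q₀))
      (extChartAt (𝓡 4) (F.ι q₀)).target U (F.coordMap q₀) (F.coordL q₀) (F.coordLbar q₀)
      (F.coordV q₀) e)
    (hq : q ∈ (extChartAt I q₀).source) (hqU : extChartAt I q₀ q ∈ U) :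
    F.IsFrame q (fun A ↦ tangentCoordChange I q₀ q q (e A (extChartAt I q₀ q))) := by
  constructor
  · intro A
    refine (hU.dirDeriv_v hq hqU _).trans ?_
    rw [tangentCoordChange_symm hq]
    exact h.v_e hqU A
  · intro A B
    refine (hU.slash_eq hq hqU _ _).trans ?_
    rw [tangentCoordChange_symm hq, tangentCoordChange_symm hq]
    exact h.e_e hqU A B

/-- The divergence of a `1`-form on the leaves in coordinates. -/
theorem div_eq (hU : F.IsCoordDomain q₀ U)
    (h : LocalNullFoliation (g.inChart (F.ι q₀)) (g.symbol (F.ι q₀))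
      (extChartAt (𝓡 4) (F.ι q₀)).target U (F.coordMap q₀) (F.coordL q₀) (F.coordLbar q₀)
      (F.coordV q₀) e)
    (hq₀U : extChartAt I q₀ q₀ ∈ U) (he : ∀ A, e A (extChartAt I q₀ q₀) = F.e q₀ A)
    {ξ : (q : H) → TangentSpace I q → ℝ} (l : (q : H) → TangentSpace I q →ₗ[ℝ] ℝ)
    (hl : ∀ q X, ξ q X = l q X) {ξ' : Fin 2 → EuclideanSpace ℝ (Fin 3) → ℝ}
    (hξ' : ∀ A, ContDiffOn ℝ ∞ (ξ' A) U)
    (hξ : ∀ q ∈ (extChartAt I q₀).source, extChartAt I q₀ q ∈ U → ∀ A,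
      ξ q (tangentCoordChange I q₀ q q (e A (extChartAt I q₀ q))) = ξ' A (extChartAt I q₀ q)) :
    F.div ξ q₀ = ∑ A, g.inChart (F.ι q₀) (F.coordMap q₀ (extChartAt I q₀ q₀))
      (localCov (g.symbol (F.ι q₀)) (F.coordMap q₀) U
        (fun y ↦ ∑ B, ξ' B y • fderivWithin ℝ (F.coordMap q₀) U y (e B y)) (extChartAt I q₀ q₀)
        (e A (extChartAt I q₀ q₀)))
      (fderivWithin ℝ (F.coordMap q₀) U (extChartAt I q₀ q₀) (e A (extChartAt I q₀ q₀))) := by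
  have hq₀ := mem_extChartAt_source (I := I) q₀
  have hS : ∀ A, tangentCoordChange I q₀ q₀ q₀ (F.e q₀ A) = e A (extChartAt I q₀ q₀) := fun A ↦
    (tangentCoordChange_self hq₀).trans (he A).symm
  rw [NullFoliation.div_eq]
  refine Finset.sum_congr rfl fun A _ ↦ ?_
  have h1 := hU.D_eq hq₀ hq₀U (Y := fun q' ↦ F.push q' (F.sharp ξ q'))
    (Y' := fun y ↦ ∑ B, ξ' B y • fderivWithin ℝ (F.coordMap q₀) U y (e B y))
    (ContDiffOn.sum fun B _ ↦ (hξ' B).smul (h.contDiffOn_push (h.contDiffOn_e B)))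
    (fun q hq hqU ↦ by
      refine (hU.push_eq hq hqU _).trans ?_
      -- The dual field is defined with the bases `F.e`, but it is independent of them; in the
      -- smooth frame its coefficients are the smooth functions `ξ'`.
      have h2 := congrArg (fun X : EuclideanSpace ℝ (Fin 3) ↦
        fderivWithin ℝ (F.coordMap q₀) U (extChartAt I q₀ q) (tangentCoordChange I q q₀ q X))
        ((hU.isFrame h hq hqU).sharp_eq (l q) (hl q))
      refine h2.trans ?_
      simp only [hξ q hq hqU]
      have h4 : ∀ c : Fin 2 → ℝ, fderivWithin ℝ (F.coordMap q₀) U (extChartAt I q₀ q)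
          (tangentCoordChange I q q₀ q
            (∑ B, c B • tangentCoordChange I q₀ q q (e B (extChartAt I q₀ q)))) =
          ∑ B, c B • fderivWithin ℝ (F.coordMap q₀) U (extChartAt I q₀ q)
            (e B (extChartAt I q₀ q)) := fun c ↦ by
        simp only [map_sum, map_smul, tangentCoordChange_symm hq]
      exact h4 _) (F.e q₀ A)
  have h3 := hU.push_eq hq₀ hq₀U (F.e q₀ A)
  rw [hS] at h1 h3
  exact hU.inner_eq hq₀ hq₀U _ _ h1 h3

end IsCoordDomain

end NullFoliation

end

noncomputable section

/-! ### Divergence of the torsion forms, and the conclusion. -/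

namespace LocalNullFoliation

variable {E F : Type*} [NormedAddCommGroup E] [NormedSpace ℝ E]
  [NormedAddCommGroup F] [NormedSpace ℝ F]
  {G : F → F →L[ℝ] F →L[ℝ] ℝ} {Γ : F → F →L[ℝ] F →L[ℝ] F} {W : Set F}
  {U : Set E} {f : E → F} {L : E → E} {m : E → F} {v : E → ℝ} {e : Fin 2 → E → E}

theorem contDiffOn_zeta (h : LocalNullFoliation G Γ W U f L m v e) (A : Fin 2) :
    ContDiffOn ℝ ∞ (fun y ↦ 1 / 2 * G (f y)
      (localCov Γ f U (fun y ↦ fderivWithin ℝ f U y (L y)) y (e A y)) (m y)) U :=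
  contDiffOn_const.mul (h.contDiffOn_metric
    (h.contDiffOn_cov (h.contDiffOn_e A) (h.contDiffOn_push h.contDiffOn_L)) h.contDiffOn_m)

theorem contDiffOn_log_lapse (h : LocalNullFoliation G Γ W U f L m v e) :
    ContDiffOn ℝ ∞ (fun y ↦ Real.log (fderivWithin ℝ v U y (L y))) U :=
  ((h.contDiffOn_v.fderivWithin h.uniqueDiffOn (by simp)).clm_apply h.contDiffOn_L).log
    fun _ hy ↦ (h.lapse_pos hy).ne'

theorem contDiffOn_dlog_lapse (h : LocalNullFoliation G Γ W U f L m v e) (A : Fin 2) :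
    ContDiffOn ℝ ∞ (fun y ↦
      fderivWithin ℝ (fun y ↦ Real.log (fderivWithin ℝ v U y (L y))) U y (e A y)) U :=
  (h.contDiffOn_log_lapse.fderivWithin h.uniqueDiffOn (by simp)).clm_apply (h.contDiffOn_e A)

theorem contDiffOn_chibar (h : LocalNullFoliation G Γ W U f L m v e) (A : Fin 2) :
    ContDiffOn ℝ ∞ (fun y ↦ G (f y) (localCov Γ f U m y (e A y))
      (fderivWithin ℝ f U y (e A y))) U :=
  h.contDiffOn_metric (h.contDiffOn_cov (h.contDiffOn_e A) h.contDiffOn_m)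
    (h.contDiffOn_push (h.contDiffOn_e A))

/-- The relation `div η̲ = - div ζ - Δ log Ω` on the leaves. -/
theorem div_etabar (h : LocalNullFoliation G Γ W U f L m v e) (hF : Module.finrank ℝ F = 4)
    {y : E} (hy : y ∈ U) :
    ∑ A, G (f y) (localCov Γ f U (fun y ↦ ∑ B, (1 / 2 * G (f y) (localCov Γ f U m y (L y))
        (fderivWithin ℝ f U y (e B y))) • fderivWithin ℝ f U y (e B y)) y (e A y))
        (fderivWithin ℝ f U y (e A y)) =
      - ∑ A, G (f y) (localCov Γ f U (fun y ↦ ∑ B, (1 / 2 * G (f y)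
          (localCov Γ f U (fun y ↦ fderivWithin ℝ f U y (L y)) y (e B y)) (m y)) •
            fderivWithin ℝ f U y (e B y)) y (e A y)) (fderivWithin ℝ f U y (e A y))
      - ∑ A, G (f y) (localCov Γ f U (fun y ↦ ∑ B,
          fderivWithin ℝ (fun y ↦ Real.log (fderivWithin ℝ v U y (L y))) U y (e B y) •
            fderivWithin ℝ f U y (e B y)) y (e A y)) (fderivWithin ℝ f U y (e A y)) := by
  have hu := h.uniqueDiffOn y hy
  have hd : ∀ {ξ : Fin 2 → E → ℝ}, (∀ A, ContDiffOn ℝ ∞ (ξ A) U) →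
      DifferentiableWithinAt ℝ (fun y ↦ ∑ B, ξ B y • fderivWithin ℝ f U y (e B y)) U y :=
    fun hξ ↦ (ContDiffOn.sum fun B _ ↦ (hξ B).smul
      (h.contDiffOn_push (h.contDiffOn_e B))).differentiableOn (by simp) y hy
  have hζ := hd h.contDiffOn_zeta
  have hl := hd h.contDiffOn_dlog_lapse
  rw [← Finset.sum_neg_distrib, ← Finset.sum_sub_distrib]
  refine Finset.sum_congr rfl fun A _ ↦ ?_
  have h1 := localCov_add (Γ := Γ) (f := f) hu (hζ.const_smul (-1 : ℝ)) (hl.const_smul (-1 : ℝ))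
    (e A y)
  have h2 := localCov_const_smul (Γ := Γ) (f := f) hu hζ (-1) (e A y)
  have h3 := localCov_const_smul (Γ := Γ) (f := f) hu hl (-1) (e A y)
  -- The relation `η̲ = -ζ - d log Ω` holds throughout `U`, not only at `y`, and may therefore be
  -- differentiated.
  rw [localCov_congr hy (fun y' hy' ↦ ?_) (e A y), h1.trans (congrArg₂ _ h2 h3)]
  · simp only [neg_smul, one_smul, map_add, map_neg, add_apply, neg_apply]
    ring
  · simp only [h.etabar_eq hF hy', sub_smul, neg_smul, one_smul, Finset.sum_sub_distrib,
      Finset.sum_neg_distrib, Pi.smul_apply]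
    abel

end LocalNullFoliation

namespace NullFoliation

variable {M : Type*} [TopologicalSpace M] [ChartedSpace R4 M] [IsManifold (𝓡 4) ∞ M]
  {g : LorentzMetric M}
  {K : Type*} [TopologicalSpace K] {I : ModelWithCorners ℝ (EuclideanSpace ℝ (Fin 3)) K}
  {H : Type*} [TopologicalSpace H] [ChartedSpace K H] [IsManifold I ∞ H]
  {F : NullFoliation g I H} {q₀ q : H} {U : Set (EuclideanSpace ℝ (Fin 3))}
  {e : Fin 2 → EuclideanSpace ℝ (Fin 3) → EuclideanSpace ℝ (Fin 3)}

namespace IsCoordDomain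

theorem tr_chibar_eq (hU : F.IsCoordDomain q₀ U)
    (h : LocalNullFoliation (g.inChart (F.ι q₀)) (g.symbol (F.ι q₀))
      (extChartAt (𝓡 4) (F.ι q₀)).target U (F.coordMap q₀) (F.coordL q₀) (F.coordLbar q₀)
      (F.coordV q₀) e)
    (hq : q ∈ (extChartAt I q₀).source) (hqU : extChartAt I q₀ q ∈ U) :
    F.tr F.chibar q = ∑ A, g.inChart (F.ι q₀) (F.coordMap q₀ (extChartAt I q₀ q))
      (localCov (g.symbol (F.ι q₀)) (F.coordMap q₀) U (F.coordLbar q₀) (extChartAt I q₀ q)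
        (e A (extChartAt I q₀ q)))
      (fderivWithin ℝ (F.coordMap q₀) U (extChartAt I q₀ q) (e A (extChartAt I q₀ q))) := by
  rw [(hU.isFrame h hq hqU).tr_chibar]
  refine Finset.sum_congr rfl fun A _ ↦ (hU.chibar_eq hq hqU _ _).trans ?_
  rw [tangentCoordChange_symm hq]

/-- The curvature is defined in the chart around the point itself. At the centre `q₀` this is the
fixed chart, so the coordinate changes are the identity and no transformation law for the curvature
is required. -/
theorem rho_eq (hU : F.IsCoordDomain q₀ U) (hq₀U : extChartAt I q₀ q₀ ∈ U) :
    F.rho q₀ = 1 / 4 * g.inChart (F.ι q₀) (F.coordMap q₀ (extChartAt I q₀ q₀))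
      (F.coordLbar q₀ (extChartAt I q₀ q₀))
      (localRiemann (g.symbol (F.ι q₀)) (F.coordMap q₀ (extChartAt I q₀ q₀))
        (F.coordLbar q₀ (extChartAt I q₀ q₀))
        (fderivWithin ℝ (F.coordMap q₀) U (extChartAt I q₀ q₀)
          (F.coordL q₀ (extChartAt I q₀ q₀)))
        (fderivWithin ℝ (F.coordMap q₀) U (extChartAt I q₀ q₀)
          (F.coordL q₀ (extChartAt I q₀ q₀)))) := by
  have hq₀ := mem_extChartAt_source (I := I) q₀
  have hx := mem_extChartAt_source (I := 𝓡 4) (F.ι q₀)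
  have hL := hU.push_L hq₀ hq₀U
  have hm := (coordLbar_eq (F := F) hq₀).symm
  refine congrArg (1 / 4 * ·) (hU.inner_eq hq₀ hq₀U _ _ hm ?_)
  refine (tangentCoordChange_self hx).trans ((g.riemann_eq (F.ι q₀) _ _ _).trans ?_)
  rw [coordMap_eq hq₀, ← hL, ← hm]
  exact congrArg₂ (fun m l : R4 ↦
    localRiemann (g.symbol (F.ι q₀)) (extChartAt (𝓡 4) (F.ι q₀) (F.ι q₀)) m l l)
    (tangentCoordChange_self hx).symm (tangentCoordChange_self hx).symm

theorem div_zeta (hU : F.IsCoordDomain q₀ U)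
    (h : LocalNullFoliation (g.inChart (F.ι q₀)) (g.symbol (F.ι q₀))
      (extChartAt (𝓡 4) (F.ι q₀)).target U (F.coordMap q₀) (F.coordL q₀) (F.coordLbar q₀)
      (F.coordV q₀) e)
    (hq₀U : extChartAt I q₀ q₀ ∈ U) (he : ∀ A, e A (extChartAt I q₀ q₀) = F.e q₀ A) :
    F.div F.zeta q₀ = ∑ A, g.inChart (F.ι q₀) (F.coordMap q₀ (extChartAt I q₀ q₀))
      (localCov (g.symbol (F.ι q₀)) (F.coordMap q₀) U
        (fun y ↦ ∑ B, (1 / 2 * g.inChart (F.ι q₀) (F.coordMap q₀ y)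
          (localCov (g.symbol (F.ι q₀)) (F.coordMap q₀) U
            (fun y ↦ fderivWithin ℝ (F.coordMap q₀) U y (F.coordL q₀ y)) y (e B y))
          (F.coordLbar q₀ y)) • fderivWithin ℝ (F.coordMap q₀) U y (e B y)) (extChartAt I q₀ q₀)
        (e A (extChartAt I q₀ q₀)))
      (fderivWithin ℝ (F.coordMap q₀) U (extChartAt I q₀ q₀) (e A (extChartAt I q₀ q₀))) := by
  refine hU.div_eq h hq₀U he F.zetaLin (fun _ _ ↦ rfl) h.contDiffOn_zeta fun q hq hqU A ↦ ?_
  refine (hU.zeta_eq hq hqU _).trans ?_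
  rw [tangentCoordChange_symm hq]

theorem laplacian_log_lapse (hU : F.IsCoordDomain q₀ U)
    (h : LocalNullFoliation (g.inChart (F.ι q₀)) (g.symbol (F.ι q₀))
      (extChartAt (𝓡 4) (F.ι q₀)).target U (F.coordMap q₀) (F.coordL q₀) (F.coordLbar q₀)
      (F.coordV q₀) e)
    (hq₀U : extChartAt I q₀ q₀ ∈ U) (he : ∀ A, e A (extChartAt I q₀ q₀) = F.e q₀ A) :
    F.laplacian (fun q ↦ Real.log (F.lapse q)) q₀ =
      ∑ A, g.inChart (F.ι q₀) (F.coordMap q₀ (extChartAt I q₀ q₀))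
      (localCov (g.symbol (F.ι q₀)) (F.coordMap q₀) U
        (fun y ↦ ∑ B, fderivWithin ℝ (fun y ↦ Real.log
          (fderivWithin ℝ (F.coordV q₀) U y (F.coordL q₀ y))) U y (e B y) •
            fderivWithin ℝ (F.coordMap q₀) U y (e B y)) (extChartAt I q₀ q₀)
        (e A (extChartAt I q₀ q₀)))
      (fderivWithin ℝ (F.coordMap q₀) U (extChartAt I q₀ q₀) (e A (extChartAt I q₀ q₀))) := by
  refine hU.div_eq h hq₀U he
    (fun q ↦ (mfderiv I 𝓘(ℝ, ℝ) (fun q ↦ Real.log (F.lapse q)) q).toLinearMap) (fun _ _ ↦ rfl)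
    h.contDiffOn_dlog_lapse fun q hq hqU A ↦ ?_
  refine ((hU.dirDeriv_eq hq hqU h.contDiffOn_log_lapse fun q hq hqU ↦
    congrArg Real.log (hU.lapse_eq hq hqU)).2 _).trans ?_
  rw [tangentCoordChange_symm hq]

/-- The vacuum equations and the curvature component `ρ`. -/
theorem sum_riemann_eq (hU : F.IsCoordDomain q₀ U)
    (h : LocalNullFoliation (g.inChart (F.ι q₀)) (g.symbol (F.ι q₀))
      (extChartAt (𝓡 4) (F.ι q₀)).target U (F.coordMap q₀) (F.coordL q₀) (F.coordLbar q₀)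
      (F.coordV q₀) e)
    (hg : g.IsVacuum) (hq₀U : extChartAt I q₀ q₀ ∈ U) :
    ∑ A, g.inChart (F.ι q₀) (F.coordMap q₀ (extChartAt I q₀ q₀))
      (localRiemann (g.symbol (F.ι q₀)) (F.coordMap q₀ (extChartAt I q₀ q₀))
        (fderivWithin ℝ (F.coordMap q₀) U (extChartAt I q₀ q₀)
          (F.coordL q₀ (extChartAt I q₀ q₀)))
        (fderivWithin ℝ (F.coordMap q₀) U (extChartAt I q₀ q₀) (e A (extChartAt I q₀ q₀)))
        (F.coordLbar q₀ (extChartAt I q₀ q₀)))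
      (fderivWithin ℝ (F.coordMap q₀) U (extChartAt I q₀ q₀) (e A (extChartAt I q₀ q₀))) =
      2 * F.rho q₀ := by
  have h1 := h.isNullFrame hq₀U
  rw [hU.rho_eq hq₀U]
  rw [coordMap_eq (mem_extChartAt_source q₀)] at h1 ⊢
  rw [hg.sum_riemann (F.ι q₀) h1]
  ring

end IsCoordDomain

end NullFoliation

end

theorem lemma2p4 {M : Type*} [TopologicalSpace M] [ChartedSpace R4 M] [IsManifold (𝓡 4) ∞ M]
    (g : LorentzMetric M) (hg : g.IsVacuum)
    {K : Type*} [TopologicalSpace K] (I : ModelWithCorners ℝ (EuclideanSpace ℝ (Fin 3)) K)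
    {H : Type*} [TopologicalSpace H] [ChartedSpace K H] [IsManifold I ∞ H]
    (F : NullFoliation g I H) (hF : F.IsCanonical) (q : H) :
    MDifferentiableAt I 𝓘(ℝ, ℝ) (F.tr F.chibar) q ∧
      dirDeriv I (F.tr F.chibar) q (F.L q) + 1 / 2 * F.tr F.chi q * F.tr F.chibar q =
        2 * F.leafMean F.rhoCheck (F.v q) + 2 * F.normSq F.etabar q := by
  obtain ⟨U, e, hU, hqU, h, he⟩ := F.exists_localNullFoliation q
  have hq := mem_extChartAt_source (I := I) q
  have hS : ∀ A, tangentCoordChange I q q q (F.e q A) = e A (extChartAt I q q) := fun A ↦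
    (tangentCoordChange_self hq).trans (he A).symm
  -- In the smooth frame `tr χ̲` has a smooth coordinate expression near `q`; this gives its
  -- differentiability together with its derivative.
  obtain ⟨hd, hD⟩ := hU.dirDeriv_eq hq hqU (ContDiffOn.sum fun A _ ↦ h.contDiffOn_chibar A)
    (fun _ hq hqU ↦ hU.tr_chibar_eq h hq hqU)
  refine ⟨hd, ?_⟩
  have h1 := hD (F.L q)
  rw [← NullFoliation.IsCoordDomain.coordL_eq hq] at h1
  have h2 := h1.trans (h.transport (by simp) hqU)
  rw [h.div_etabar (by simp) hqU, ← hU.div_zeta h hqU he, ← hU.laplacian_log_lapse h hqU he,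
    hU.sum_riemann_eq h hg hqU] at h2
  have hχ : ∀ A B, F.chi q (F.e q A) (F.e q B) = _ := fun A B ↦ hU.chi_eq hq hqU _ _
  have hχ' : ∀ A B, F.chibar q (F.e q A) (F.e q B) = _ := fun A B ↦ hU.chibar_eq hq hqU _ _
  have hη : ∀ A, F.etabar q (F.e q A) = _ := fun A ↦ hU.etabar_eq hq hqU _
  simp only [hS] at hχ hχ' hη
  simp only [← hχ, ← hχ', ← hη] at h2
  -- The transport equation now contains `-2 div ζ - 2 △ log Ω`, which the canonical equation
  -- replaces by `2 mean(ρ̌) - 2ρ̌`. With `ρ̌` expanded, the terms in `ρ` and `χ·χ̲` cancel, leaving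
  -- `-½ tr χ tr χ̲`.
  have h3 := hF.elliptic q
  rw [NullFoliation.rhoCheck, F.dot₂_hat, NullFoliation.dot₂] at h3
  rw [NullFoliation.normSq]
  linarith
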